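/- Let $\mathbb D=\{z\in\mathbb C:|z|<1\}$, let $m$ be the area measure, and for $0<\alpha<2$ let $\mathcal D_\alpha$ be the weighted Dirichlet space of all analytic functions $f$ on $\mathbb D$ with $$\|f\|_{\mathcal D_\alpha}^2=|f(0)|^2+\iint_{\mathbb D}|f'(z)|^2(1-|z|)^\alpha\,dm(z)<\infty .$$ For $f\in\mathcal D_\alpha$ and $z\in\mathbb D$ put $$\mathcal C(f)(z)=\frac1z\int_0^z\frac{f(\zeta)}{1-\zeta}\,d\zeta,\qquad \mathcal A(f)(z)=\frac1{z-1}\int_1^z f(\zeta)\,d\zeta,\qquad \mathcal J(f)(z)=\frac1{z-1}\int_1^z\frac{f(\zeta)}{-1-\zeta}\,d\zeta,$$ $$\mathcal H(f)(z)=\int_0^1\frac{f(\zeta)}{1-\zeta z}\,d\zeta,\qquad \mathcal H_0(f)(z)=\frac12\int_{-1}^1\frac{f(\zeta)}{1-\zeta z}\,d\zeta,$$ where the integrals are taken along line segments and $\mathcal C(f)(0)=f(0)$ (the limit as $z\to0$). Then for every $0<\alpha<2$ these integrals converge absolutely for all $f\in\mathcal D_\alpha$ and $z\in\mathbb D$,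 and each of the operators $T\in\{\mathcal C,\mathcal A,\mathcal J,\mathcal H,\mathcal H_0\}$ is a bounded linear operator on $\mathcal D_\alpha$: it is linear, maps $\mathcal D_\alpha$ into itself, and there is a constant $C=C(\alpha,T)$ with $\|T(f)\|_{\mathcal D_\alpha}\le C\|f\|_{\mathcal D_\alpha}$ for all $f\in\mathcal D_\alpha$. -/

import Mathlib

open MeasureTheory Metric

namespace WeightedDirichlet

noncomputable section

/-- The integrand `|f'(z)|² (1 - |z|)^α` of the weighted Dirichlet integral. -/
def energyDensity (α : ℝ) (f : ℂ → ℂ) (z : ℂ) : ℝ :=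
  ‖deriv f z‖ ^ 2 * (1 - ‖z‖) ^ α

/-- The weighted Dirichlet space `D_α`: functions that are analytic in the open unit disc and have
finite weighted Dirichlet integral. Only the values of `f` in the open unit disc matter. -/
def Space (α : ℝ) : Set (ℂ → ℂ) :=
  {f | DifferentiableOn ℂ f (ball 0 1) ∧
    IntegrableOn (energyDensity α f) (ball 0 1) volume}

/-- The norm `‖f‖ = (|f(0)|² + ∬ |f'(z)|² (1 - |z|)^α dm(z))^{1/2}` of `D_α`, where `m` is the
area measure. -/
def norm (α : ℝ) (f : ℂ → ℂ) : ℝ :=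
  Real.sqrt (‖f 0‖ ^ 2 + ∫ z in ball (0 : ℂ) 1, energyDensity α f z)

/-- `g` is absolutely integrable along the line segment from `a` to `b`. -/
def SegmentIntegrable (a b : ℂ) (g : ℂ → ℂ) : Prop :=
  IntervalIntegrable (fun t : ℝ => g (a + (t : ℂ) * (b - a))) volume 0 1

/-- The integral `∫_a^b g(ζ) dζ` along the line segment from `a` to `b`. -/
def segmentIntegral (a b : ℂ) (g : ℂ → ℂ) : ℂ :=
  (b - a) * ∫ t in (0 : ℝ)..1, g (a + (t : ℂ) * (b - a))

/-- The Cesàro operator `C(f)(z) = (1/z) ∫_0^z f(ζ)/(1 - ζ) dζ`; at the removable singularity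
`z = 0` the value is the limit `f(0)`. -/
def cesaro (f : ℂ → ℂ) (z : ℂ) : ℂ :=
  if z = 0 then f 0 else 1 / z * segmentIntegral 0 z (fun ζ => f ζ / (1 - ζ))

/-- The operator `A(f)(z) = (1/(z - 1)) ∫_1^z f(ζ) dζ`. -/
def opA (f : ℂ → ℂ) (z : ℂ) : ℂ :=
  1 / (z - 1) * segmentIntegral 1 z f

/-- The operator `J(f)(z) = (1/(z - 1)) ∫_1^z f(ζ)/(-1 - ζ) dζ`. -/
def opJ (f : ℂ → ℂ) (z : ℂ) : ℂ :=
  1 / (z - 1) * segmentIntegral 1 z (fun ζ => f ζ / (-1 - ζ))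

/-- The Hilbert operator `H(f)(z) = ∫_0^1 f(ζ)/(1 - ζ z) dζ`. -/
def hilbert (f : ℂ → ℂ) (z : ℂ) : ℂ :=
  segmentIntegral 0 1 (fun ζ => f ζ / (1 - ζ * z))

/-- The reduced Hilbert operator `H₀(f)(z) = (1/2) ∫_{-1}^1 f(ζ)/(1 - ζ z) dζ`. -/
def reducedHilbert (f : ℂ → ℂ) (z : ℂ) : ℂ :=
  1 / 2 * segmentIntegral (-1) 1 (fun ζ => f ζ / (1 - ζ * z))

/-- `T` is a bounded linear operator from `D_α` to itself. Functions on the unit disc are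
represented by functions on `ℂ`, so linearity is an identity between values in the disc. -/
def IsBoundedOperator (α : ℝ) (T : (ℂ → ℂ) → ℂ → ℂ) : Prop :=
  (∀ f ∈ Space α, T f ∈ Space α) ∧
  (∀ f ∈ Space α, ∀ g ∈ Space α, ∀ c : ℂ, ∀ z ∈ ball (0 : ℂ) 1,
    T (fun w => c * f w + g w) z = c * T f z + T g z) ∧
  (∃ C : ℝ, ∀ f ∈ Space α, norm α (T f) ≤ C * norm α f)

end

end WeightedDirichlet

/-! Every operator is written as an integral over a parameter in `(0, 1)`, and its weighted `L²`
norm is estimated either by Minkowski's inequality (each slice has norm at most a constant times `t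
^ (-a)` with `a < 1`) or by Schur's test. Both come from one weighted Cauchy–Schwarz argument,
`lintegral_sq_lintegral_le`. Squared norms are handled as lower Lebesgue integrals in `[0, ∞]`, so
that boundedness becomes an inequality `sqNorm α (T f) ≤ C * sqNorm α f` with finite `C`.

Two facts about the space carry the estimates. The first is growth: the sub-mean value property
gives `|f'(z)| ≲ (1 - |z|)^(-1-α/2)`, hence `|f(z)| ≲ (1 - |z|)^(-α/2)`. The second is a Hardy
inequality, `f / (1 - z) ∈ L²((1 - |z|)^α dm)`. To prove it, join `0` to `z` by the curve `φ_q(z) =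
q z / (1 - (1 - q) z)`, `0 ≤ q ≤ 1`. Its velocity in `q` contains the factor `1 - z`, so `(f(z) -
f(0)) / (1 - z)` is an average of `f' ∘ φ_q` with explicit factors. Each `φ_q` with `0 < q < 1` is
an injective self-map of the disc, and a change of variables bounds the slice norm by a constant
times `q^(α/2 - 1)`, integrable because `α > 0`.

The operators `C`, `A`, `J` are means `M g` over segments from `p = 0, 1, 1`, with `g = f / (1 -
ζ)`, `f`, `f / (-1 - ζ)`. For `A` one differentiates under the integral: the slices of `(M f)'` have
norm of order `t^(-α/2)`, and `α < 2` makes this integrable. For `C` and `J` the function `g` has a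
pole on the circle, and differentiating would worsen it. Away from `p` one uses `(z - p) (M g)' = g
- M g` together with Hardy's inequality for `g`. Near `p` the pole is far away and direct estimates
suffice.

For the Hilbert operator, averaging over discs centred on the radius turns Hardy's inequality into
the trace estimate `∫ |f(1 - s)|² s^(α-1) ds ≲ ‖f‖²`. The derivative of `H f` is dominated by the
integral of `|f(1 - s)|` against `(s + |1 - z|)^(-2)`, and Schur's test with weight `s^(-α/2)` maps
the trace space into the weighted `L²` space. The operator `H₀` is half the sum of `H` and its
conjugate by `z ↦ -z`. -/

namespace WeightedDirichlet
open scoped ENNReal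

/-! ### The weighted measure and the norm with values in `[0, ∞]`. -/

/-- The measure `(1 - |z|)^α dm(z)` on the unit disc. -/
noncomputable def diskMeasure (α : ℝ) : Measure ℂ :=
  (volume.restrict (ball 0 1)).withDensity fun z => ENNReal.ofReal ((1 - ‖z‖) ^ α)

/-- The square of the norm of `D_α`, with values in `[0, ∞]`. -/
noncomputable def sqNorm (α : ℝ) (f : ℂ → ℂ) : ℝ≥0∞ :=
  ‖f 0‖ₑ ^ 2 + ∫⁻ z, ‖deriv f z‖ₑ ^ 2 ∂diskMeasure α

lemma measurable_weight (α : ℝ) : Measurable fun z : ℂ => ENNReal.ofReal ((1 - ‖z‖) ^ α) := by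
  fun_prop

lemma lintegral_diskMeasure (α : ℝ) (g : ℂ → ℝ≥0∞) :
    ∫⁻ z, g z ∂diskMeasure α =
      ∫⁻ z in ball (0 : ℂ) 1, ENNReal.ofReal ((1 - ‖z‖) ^ α) * g z := by
  rw [diskMeasure, lintegral_withDensity_eq_lintegral_mul_non_measurable _ (measurable_weight α)
    (by simp)]
  rfl

instance (α : ℝ) : SFinite (diskMeasure α) := by
  unfold diskMeasure; infer_instance

lemma diskMeasure_absolutelyContinuous (α : ℝ) :
    diskMeasure α ≪ volume.restrict (ball (0 : ℂ) 1) :=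
  withDensity_absolutelyContinuous _ _

lemma ae_diskMeasure_mem_ball (α : ℝ) : ∀ᵐ z ∂diskMeasure α, z ∈ ball (0 : ℂ) 1 :=
  (diskMeasure_absolutelyContinuous α).ae_le (ae_restrict_mem measurableSet_ball)

lemma lintegral_diskMeasure_mono {α : ℝ} {g h : ℂ → ℝ≥0∞}
    (H : ∀ z ∈ ball (0 : ℂ) 1, g z ≤ h z) : ∫⁻ z, g z ∂diskMeasure α ≤ ∫⁻ z, h z ∂diskMeasure α :=
  lintegral_mono_ae ((ae_diskMeasure_mem_ball α).mono H)

lemma energyDensity_nonneg {α : ℝ} {f : ℂ → ℂ} {z : ℂ} (hz : z ∈ ball (0 : ℂ) 1) :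
    0 ≤ energyDensity α f z := by
  have : ‖z‖ < 1 := by simpa using hz
  exact mul_nonneg (by positivity) (Real.rpow_nonneg (by linarith) _)

lemma measurable_energyDensity (α : ℝ) (f : ℂ → ℂ) : Measurable (energyDensity α f) := by
  have := measurable_deriv f
  unfold energyDensity
  fun_prop

lemma lintegral_energyDensity (α : ℝ) (f : ℂ → ℂ) :
    ∫⁻ z in ball (0 : ℂ) 1, ENNReal.ofReal (energyDensity α f z) =
      ∫⁻ z, ‖deriv f z‖ₑ ^ 2 ∂diskMeasure α := by
  rw [lintegral_diskMeasure]
  refine setLIntegral_congr_fun measurableSet_ball fun z _ => ?_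
  simp only [energyDensity]
  rw [ENNReal.ofReal_mul (by positivity), mul_comm, ← ofReal_norm, ENNReal.ofReal_pow (by positivity)]

lemma mem_space_iff {α : ℝ} {f : ℂ → ℂ} :
    f ∈ Space α ↔ DifferentiableOn ℂ f (ball 0 1) ∧ sqNorm α f ≠ ∞ := by
  unfold Space sqNorm
  refine and_congr_right fun _ => ?_
  rw [← lintegral_energyDensity, IntegrableOn,
    ← lt_top_iff_ne_top, ENNReal.add_lt_top, Integrable,
    hasFiniteIntegral_iff_ofReal
      ((ae_restrict_mem measurableSet_ball).mono fun z hz => energyDensity_nonneg hz)]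
  have h : ‖f 0‖ₑ ^ 2 < ∞ := by simp
  simp [(measurable_energyDensity α f).aestronglyMeasurable, h]

lemma sqNorm_eq {α : ℝ} {f : ℂ → ℂ} (hf : f ∈ Space α) :
    sqNorm α f = ENNReal.ofReal (norm α f ^ 2) := by
  have h0 : 0 ≤ ∫ z in ball (0 : ℂ) 1, energyDensity α f z :=
    setIntegral_nonneg measurableSet_ball fun z hz => energyDensity_nonneg hz
  rw [norm, Real.sq_sqrt (by positivity), ENNReal.ofReal_add (by positivity) h0,
    ofReal_integral_eq_lintegral_ofReal hf.2
      ((ae_restrict_mem measurableSet_ball).mono fun z hz => energyDensity_nonneg hz),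
    lintegral_energyDensity, sqNorm, ← ofReal_norm, ENNReal.ofReal_pow (by positivity)]

lemma norm_nonneg' (α : ℝ) (f : ℂ → ℂ) : 0 ≤ norm α f := Real.sqrt_nonneg _

/-- Boundedness of a linear operator in terms of `sqNorm`. -/
lemma isBoundedOperator_of_sqNorm_le {α : ℝ} {T : (ℂ → ℂ) → ℂ → ℂ}
    (hd : ∀ f ∈ Space α, DifferentiableOn ℂ (T f) (ball 0 1))
    (hlin : ∀ f ∈ Space α, ∀ g ∈ Space α, ∀ c : ℂ, ∀ z ∈ ball (0 : ℂ) 1,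
      T (fun w => c * f w + g w) z = c * T f z + T g z)
    (hb : ∃ C : ℝ≥0∞, C ≠ ∞ ∧ ∀ f ∈ Space α, sqNorm α (T f) ≤ C * sqNorm α f) :
    IsBoundedOperator α T := by
  obtain ⟨C, hC, hb⟩ := hb
  have hT : ∀ f ∈ Space α, T f ∈ Space α := fun f hf =>
    mem_space_iff.2 ⟨hd f hf, ne_top_of_le_ne_top
      (ENNReal.mul_ne_top hC (mem_space_iff.1 hf).2) (hb f hf)⟩
  refine ⟨hT, hlin, √C.toReal, fun f hf => ?_⟩
  have h := hb f hf
  rw [sqNorm_eq hf, sqNorm_eq (hT f hf), ← ENNReal.ofReal_toReal hC,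
    ← ENNReal.ofReal_mul (by positivity), ENNReal.ofReal_le_ofReal_iff (by positivity)] at h
  refine le_of_sq_le_sq ?_ (mul_nonneg (by positivity) (norm_nonneg' α f))
  rwa [mul_pow, Real.sq_sqrt (by positivity)]

lemma add_sq_le_two_mul (a b : ℝ≥0∞) : (a + b) ^ 2 ≤ 2 * a ^ 2 + 2 * b ^ 2 := by
  have := ENNReal.rpow_add_le_mul_rpow_add_rpow a b (p := 2) (by norm_num)
  norm_num at this
  rwa [mul_add] at this

/-! ### Weighted Cauchy–Schwarz, Schur's test and Minkowski's inequality. -/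

/-- Cauchy–Schwarz with a weight. -/
lemma sq_lintegral_le {X : Type*} [MeasurableSpace X] {ν : Measure X} {G p : X → ℝ≥0∞}
    (hG : AEMeasurable G ν) (hp : AEMeasurable p ν) (hp0 : ∀ᵐ x ∂ν, p x ≠ 0)
    (hpt : ∀ᵐ x ∂ν, p x ≠ ∞) :
    (∫⁻ x, G x ∂ν) ^ 2 ≤ (∫⁻ x, p x ∂ν) * ∫⁻ x, G x ^ 2 / p x ∂ν := by
  have h := ENNReal.lintegral_mul_le_Lp_mul_Lq ν (p := 2) (q := 2)
    Real.HolderConjugate.two_two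
    (f := fun x => p x ^ (1 / 2 : ℝ)) (g := fun x => G x / p x ^ (1 / 2 : ℝ))
    (by fun_prop) (by fun_prop)
  have e1 : ∫⁻ x, ((fun x => p x ^ (1 / 2 : ℝ)) * fun x => G x / p x ^ (1 / 2 : ℝ)) x ∂ν =
      ∫⁻ x, G x ∂ν := by
    refine lintegral_congr_ae ?_
    filter_upwards [hp0, hpt] with x h0 ht
    exact ENNReal.mul_div_cancel (by simp [h0]) (by simp [ht])
  have e2 : ∀ x, (p x ^ (1 / 2 : ℝ)) ^ (2 : ℝ) = p x := fun x => by
    rw [← ENNReal.rpow_mul]; norm_num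
  have e3 : ∀ x, (G x / p x ^ (1 / 2 : ℝ)) ^ (2 : ℝ) = G x ^ 2 / p x := fun x => by
    rw [ENNReal.div_rpow_of_nonneg _ _ (by norm_num), e2]; norm_num
  simp only [e1, e2, e3] at h
  calc (∫⁻ x, G x ∂ν) ^ 2 ≤ _ := pow_le_pow_left' h 2
    _ = _ := by
      rw [mul_pow, ← ENNReal.rpow_natCast, ← ENNReal.rpow_natCast, ← ENNReal.rpow_mul,
        ← ENNReal.rpow_mul]
      norm_num

/-- Schur's test. -/
lemma lintegral_sq_lintegral_le {X Y : Type*} [MeasurableSpace X] [MeasurableSpace Y]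
    {ν : Measure X} {μ : Measure Y} [SFinite ν] [SFinite μ] {G p : X → Y → ℝ≥0∞} {P : Y → ℝ≥0∞}
    (hG : AEMeasurable (Function.uncurry G) (ν.prod μ))
    (hp : AEMeasurable (Function.uncurry p) (ν.prod μ)) (hPm : AEMeasurable P μ)
    (hp0 : ∀ᵐ y ∂μ, ∀ᵐ x ∂ν, p x y ≠ 0) (hpt : ∀ᵐ y ∂μ, ∀ᵐ x ∂ν, p x y ≠ ∞)
    (hP : ∀ᵐ y ∂μ, ∫⁻ x, p x y ∂ν ≤ P y) :
    ∫⁻ y, (∫⁻ x, G x y ∂ν) ^ 2 ∂μ ≤ ∫⁻ x, ∫⁻ y, P y * (G x y ^ 2 / p x y) ∂μ ∂ν := by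
  have hP' : AEMeasurable (Function.uncurry fun (_ : X) (y : Y) => P y) (ν.prod μ) :=
    hPm.comp_quasiMeasurePreserving Measure.quasiMeasurePreserving_snd
  have hF : AEMeasurable (Function.uncurry fun x y => P y * (G x y ^ 2 / p x y)) (ν.prod μ) :=
    hP'.mul ((hG.pow_const 2).div hp)
  rw [lintegral_lintegral_swap hF]
  refine lintegral_mono_ae ?_
  have hG' := hG.prod_swap.aestronglyMeasurable.prodMk_left
  have hp' := hp.prod_swap.aestronglyMeasurable.prodMk_left
  filter_upwards [hp0, hpt, hP, hG', hp'] with y h0 ht h hGy' hpy'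
  have hGy : AEMeasurable (fun x => G x y) ν := hGy'.aemeasurable
  have hpy : AEMeasurable (fun x => p x y) ν := hpy'.aemeasurable
  calc _ ≤ _ := sq_lintegral_le hGy hpy h0 ht
    _ ≤ P y * ∫⁻ x, G x y ^ 2 / p x y ∂ν := by gcongr
    _ = _ := (lintegral_const_mul'' _ ((hGy.pow_const 2).div hpy)).symm

lemma lintegral_Ioo_rpow {a : ℝ} (ha : -1 < a) :
    ∫⁻ t in Set.Ioo (0 : ℝ) 1, ENNReal.ofReal (t ^ a) = ENNReal.ofReal (1 / (a + 1)) := by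
  have hi := (intervalIntegral.intervalIntegrable_rpow' (a := 0) (b := 1) ha)
  rw [intervalIntegrable_iff_integrableOn_Ioo_of_le zero_le_one] at hi
  rw [← ofReal_integral_eq_lintegral_ofReal hi
    ((ae_restrict_mem measurableSet_Ioo).mono fun t ht => Real.rpow_nonneg ht.1.le _),
    ← integral_Ioc_eq_integral_Ioo, ← intervalIntegral.integral_of_le zero_le_one,
    integral_rpow (Or.inl ha), Real.one_rpow, Real.zero_rpow (by linarith), sub_zero]

/-- A form of Minkowski's integral inequality in `L²`. -/
lemma lintegral_sq_lintegral_Ioo_le {Y : Type*} [MeasurableSpace Y] {μ : Measure Y} [SFinite μ]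
    {G : ℝ → Y → ℝ≥0∞} {a : ℝ} {M : ℝ≥0∞} (ha : a < 1)
    (hG : AEMeasurable (Function.uncurry G) ((volume.restrict (Set.Ioo 0 1)).prod μ))
    (h : ∀ t ∈ Set.Ioo (0 : ℝ) 1, ∫⁻ y, G t y ^ 2 ∂μ ≤ M * ENNReal.ofReal (t ^ (-(2 * a)))) :
    ∫⁻ y, (∫⁻ t in Set.Ioo (0 : ℝ) 1, G t y) ^ 2 ∂μ ≤
      ENNReal.ofReal (1 / (1 - a)) ^ 2 * M := by
  have hI := lintegral_Ioo_rpow (a := -a) (by linarith)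
  rw [show -a + 1 = 1 - a by ring] at hI
  set K := ENNReal.ofReal (1 / (1 - a))
  -- The Schur weight is the assumed slice bound itself: dividing `t ^ (-2a)` by it leaves `t ^
  -- (-a)`, so the same integral `1 / (1 - a)` occurs twice.
  refine (lintegral_sq_lintegral_le (p := fun t _ => ENNReal.ofReal (t ^ (-a)))
    (P := fun _ => K) hG
    (by unfold Function.uncurry; fun_prop) (by fun_prop) (Filter.Eventually.of_forall fun _ => ?_)
    (Filter.Eventually.of_forall fun _ => by simp)
    (Filter.Eventually.of_forall fun _ => hI.le)).trans ?_
  · filter_upwards [ae_restrict_mem measurableSet_Ioo] with t ht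
    simpa using Real.rpow_pos_of_pos ht.1 _
  · calc _ ≤ ∫⁻ t in Set.Ioo (0 : ℝ) 1, K * M * ENNReal.ofReal (t ^ (-a)) := by
          refine setLIntegral_mono_ae (by fun_prop) (Filter.Eventually.of_forall fun t ht => ?_)
          have ht0 : 0 < t ^ (-a) := Real.rpow_pos_of_pos ht.1 _
          have e : ∀ y, K * (G t y ^ 2 / ENNReal.ofReal (t ^ (-a))) =
              (K * (ENNReal.ofReal (t ^ (-a)))⁻¹) * G t y ^ 2 := fun y => by
            rw [div_eq_mul_inv]; ring
          simp only [e]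
          rw [lintegral_const_mul' _ _ (ENNReal.mul_ne_top (by simp [K]) (by simpa using ht0))]
          refine (mul_le_mul_right (h t ht) _).trans (le_of_eq ?_)
          rw [← ENNReal.ofReal_inv_of_pos ht0]
          calc _ = K * M * (ENNReal.ofReal (t ^ (-a))⁻¹ * ENNReal.ofReal (t ^ (-(2 * a)))) := by
                ring
            _ = _ := by
              rw [← ENNReal.ofReal_mul (by positivity), ← Real.rpow_neg ht.1.le,
                ← Real.rpow_add ht.1]
              ring_nf
      _ = _ := by rw [lintegral_const_mul _ (by fun_prop), hI]; ring

/-! ### Change of variables and integrability in the plane. -/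

/-- Change of variables for an injective holomorphic map. -/
lemma lintegral_comp_mul_deriv_sq_le {φ : ℂ → ℂ} {U V : Set ℂ} (hU : IsOpen U)
    (hφ : DifferentiableOn ℂ φ U) (hinj : Set.InjOn φ U) (hmaps : Set.MapsTo φ U V)
    (g : ℂ → ℝ≥0∞) :
    ∫⁻ z in U, ‖deriv φ z‖ₑ ^ 2 * g (φ z) ≤ ∫⁻ u in V, g u := by
  have h := lintegral_image_eq_lintegral_abs_det_fderiv_mul volume hU.measurableSet
    (f := φ) (f' := fun z => (ContinuousLinearMap.toSpanSingleton ℂ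
      (deriv φ z)).restrictScalars ℝ)
    (fun z hz => (((hφ.differentiableAt (hU.mem_nhds hz)).hasDerivAt.hasFDerivAt).restrictScalars
      ℝ).hasFDerivWithinAt) hinj g
  have hdet : ∀ c : ℂ, ((ContinuousLinearMap.toSpanSingleton ℂ c).restrictScalars ℝ).det =
      ‖c‖ ^ 2 := fun c => by
    simp [ContinuousLinearMap.det, LinearMap.det_restrictScalars,
      Algebra.norm_complex_eq, Complex.normSq_eq_norm_sq]
  simp only [hdet] at h
  calc _ = ∫⁻ z in U, ENNReal.ofReal |‖deriv φ z‖ ^ 2| * g (φ z) := by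
        refine lintegral_congr fun z => ?_
        rw [abs_of_nonneg (by positivity), ENNReal.ofReal_pow (by positivity), ofReal_norm]
    _ = ∫⁻ u in φ '' U, g u := h.symm
    _ ≤ _ := lintegral_mono_set hmaps.image_subset

/-- `|z|^γ` is integrable near the origin for `γ > -2`. -/
lemma lintegral_ball_rpow_lt_top {γ : ℝ} (hγ : -2 < γ) (r : ℝ) :
    ∫⁻ z in ball (0 : ℂ) r, ENNReal.ofReal (‖z‖ ^ γ) < ∞ := by
  have h := integrableOn_ball_of_norm_le_rpow (E := ℂ) (F := ℝ) (μ := volume)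
    (by simp) (f := fun z => ‖z‖ ^ γ) (C := 1) (α := -γ) (r := r)
    (by simp; linarith) (Filter.Eventually.of_forall fun z => by
      rw [Real.norm_of_nonneg (by positivity)]; simp)
    (Measurable.aestronglyMeasurable (by fun_prop))
  exact (hasFiniteIntegral_iff_ofReal (Filter.Eventually.of_forall fun z => by
    positivity)).1 h.2

lemma aemeasurable_prod_of_continuousOn {F : ℝ × ℂ → ℂ} {s : Set ℝ} {t : Set ℂ}
    (hs : MeasurableSet s) (ht : MeasurableSet t) (hF : ContinuousOn F (s ×ˢ t)) :
    AEMeasurable F ((volume.restrict s).prod (volume.restrict t)) := by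
  rw [Measure.prod_restrict]
  exact hF.aemeasurable (hs.prod ht)

lemma aemeasurable_prod_diskMeasure {F : ℝ × ℂ → ℂ} {s : Set ℝ} (α : ℝ)
    (hs : MeasurableSet s) (hF : ContinuousOn F (s ×ˢ ball 0 1)) :
    AEMeasurable F ((volume.restrict s).prod (diskMeasure α)) :=
  (aemeasurable_prod_of_continuousOn hs measurableSet_ball hF).mono_ac
    (Measure.AbsolutelyContinuous.rfl.prod (diskMeasure_absolutelyContinuous α))

/-! ### Sub-mean value property and pointwise growth. -/

lemma enorm_sq_le_lintegral_circle {g : ℂ → ℂ} {c u : ℂ} {R : ℝ}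
    (hg : DifferentiableOn ℂ g (ball c R)) (hu : ‖u‖ < R) :
    ENNReal.ofReal (2 * Real.pi) * ‖g c‖ₑ ^ 2 ≤
      ∫⁻ θ in Set.Ioc 0 (2 * Real.pi), ‖g (c + circleMap 0 1 θ * u)‖ₑ ^ 2 := by
  have hpi := Real.pi_pos
  -- The mean value property is applied to the holomorphic function `g ^ 2`, so no convexity
  -- argument is needed.
  have hd : DifferentiableOn ℂ (fun ζ : ℂ => g (c + ζ * u) ^ 2) (closedBall 0 1) := by
    refine (hg.comp (by fun_prop) fun ζ hζ => ?_).pow 2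
    have h1 : ‖ζ‖ ≤ 1 := by simpa using hζ
    rw [mem_ball, dist_eq_norm, add_sub_cancel_left, norm_mul]
    nlinarith [norm_nonneg u]
  have h := (hd.diffContOnCl_ball (c := 0) (R := |(1 : ℝ)|) (by simp)).circleAverage
  rw [Real.circleAverage_def, intervalIntegral.integral_of_le (by positivity)] at h
  have h2 : ‖g c‖ₑ ^ 2 = ‖(2 * Real.pi)⁻¹ •
      ∫ θ in Set.Ioc 0 (2 * Real.pi), g (c + circleMap 0 1 θ * u) ^ 2‖ₑ := by
    rw [h]; simp [enorm_pow]
  rw [h2, enorm_smul, ← mul_assoc, Real.enorm_of_nonneg (by positivity),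
    ← ENNReal.ofReal_mul (by positivity), mul_inv_cancel₀ (by positivity), ENNReal.ofReal_one,
    one_mul]
  refine (enorm_integral_le_lintegral_enorm _).trans (le_of_eq ?_)
  simp [enorm_pow]

/-- Rotation invariance takes the place of polar coordinates: circle means are integrated over all
`u` in the ball and Tonelli does the rest. The case `θ = 0` serves as a translation and `θ = π` as
the reflection. -/
lemma lintegral_ball_rotate (c : ℂ) (R θ : ℝ) (h : ℂ → ℝ≥0∞) :
    ∫⁻ u in ball (0 : ℂ) R, h (c + circleMap 0 1 θ * u) = ∫⁻ z in ball c R, h z := by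
  have e : circleMap 0 1 θ = (Circle.exp θ : ℂ) := by simp [circleMap]
  have h1 : MeasurePreserving (fun u => c + circleMap 0 1 θ * u) volume volume := by
    have := (measurePreserving_add_left volume c).comp
      (rotation (Circle.exp θ)).measurePreserving
    simpa [Function.comp_def, e] using this
  have h2 : MeasurableEmbedding (fun u => c + circleMap 0 1 θ * u) := by
    have := (measurableEmbedding_addLeft c).comp
      (rotation (Circle.exp θ)).toHomeomorph.measurableEmbedding
    simpa [Function.comp_def, e] using this
  rw [← h1.setLIntegral_comp_preimage_emb h2 h (ball c R)]
  congr 2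
  ext u
  simp [e]

/-- The sub-mean value property over discs. -/
lemma volume_mul_enorm_sq_le {g : ℂ → ℂ} {c : ℂ} {R : ℝ}
    (hg : DifferentiableOn ℂ g (ball c R)) :
    volume (ball c R) * ‖g c‖ₑ ^ 2 ≤ ∫⁻ z in ball c R, ‖g z‖ₑ ^ 2 := by
  have hpi := Real.pi_pos
  have hK : ENNReal.ofReal (2 * Real.pi) ≠ 0 := by simpa using hpi
  refine (ENNReal.mul_le_mul_iff_right hK ENNReal.ofReal_ne_top).1 ?_
  have hm : AEMeasurable (Function.uncurry fun (θ : ℝ) (u : ℂ) =>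
      ‖g (c + circleMap 0 1 θ * u)‖ₑ ^ 2)
      ((volume.restrict (Set.Ioc 0 (2 * Real.pi))).prod (volume.restrict (ball (0 : ℂ) R))) := by
    refine (aemeasurable_prod_of_continuousOn (F := fun x => g (c + circleMap 0 1 x.1 * x.2))
      measurableSet_Ioc measurableSet_ball ?_).enorm.pow_const 2
    refine hg.continuousOn.comp (by fun_prop) fun x hx => ?_
    simpa using hx.2
  calc _ = ∫⁻ u in ball (0 : ℂ) R, ENNReal.ofReal (2 * Real.pi) * ‖g c‖ₑ ^ 2 := by
        rw [setLIntegral_const, Measure.addHaar_ball_center]; ring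
    _ ≤ ∫⁻ u in ball (0 : ℂ) R, ∫⁻ θ in Set.Ioc 0 (2 * Real.pi),
          ‖g (c + circleMap 0 1 θ * u)‖ₑ ^ 2 :=
        lintegral_mono_ae ((ae_restrict_mem measurableSet_ball).mono fun u hu =>
          enorm_sq_le_lintegral_circle hg (by simpa using hu))
    _ = _ := by
        rw [← lintegral_lintegral_swap hm]
        simp only [lintegral_ball_rotate c R _ fun z => ‖g z‖ₑ ^ 2]
        rw [setLIntegral_const, mul_comm]
        simp

lemma volume_ball_complex (c : ℂ) {R : ℝ} (hR : 0 ≤ R) :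
    volume (ball c R) = ENNReal.ofReal (Real.pi * R ^ 2) := by
  rw [Complex.volume_ball, mul_comm, ENNReal.ofReal_mul Real.pi_pos.le,
    ENNReal.ofReal_pow hR, ENNReal.ofReal_coe_nnreal.symm]
  simp

/-- Pointwise growth of a holomorphic function in the weighted Bergman space. -/
lemma norm_le_of_lintegral_sq_le {α N : ℝ} (hα : 0 ≤ α) (hN : 0 ≤ N) {g : ℂ → ℂ}
    (hg : DifferentiableOn ℂ g (ball 0 1))
    (h : ∫⁻ z, ‖g z‖ₑ ^ 2 ∂diskMeasure α ≤ ENNReal.ofReal (N ^ 2)) {z : ℂ}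
    (hz : z ∈ ball (0 : ℂ) 1) : ‖g z‖ ≤ ((1 - ‖z‖) / 2) ^ (-(1 + α / 2)) * N := by
  have hz1 : ‖z‖ < 1 := by simpa using hz
  -- On the disc of radius `r` about `z` the weight is at least `r ^ α`, so the unweighted sub-mean
  -- value property applies.
  set r := (1 - ‖z‖) / 2 with hr
  have hr0 : 0 < r := by linarith
  have hw : ∀ w ∈ ball z r, r ≤ 1 - ‖w‖ := fun w hw => by
    have h1 : ‖w - z‖ < r := by simpa [dist_eq_norm] using hw
    have := norm_le_norm_add_norm_sub' w z
    linarith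
  have hsub : ball z r ⊆ ball 0 1 := fun w hw' => by
    have := hw w hw'
    rw [mem_ball_zero_iff]; linarith
  have h1 := volume_mul_enorm_sq_le (hg.mono hsub)
  have h2 : ENNReal.ofReal (r ^ α) * ∫⁻ w in ball z r, ‖g w‖ₑ ^ 2 ≤ ENNReal.ofReal (N ^ 2) := by
    rw [← lintegral_const_mul' _ _ ENNReal.ofReal_ne_top]
    refine le_trans ?_ h
    rw [lintegral_diskMeasure]
    refine le_trans (lintegral_mono_ae ?_) (lintegral_mono_set hsub)
    filter_upwards [ae_restrict_mem measurableSet_ball] with w hw'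
    gcongr
    exact hw w hw'
  have h3 : ENNReal.ofReal (r ^ α * (Real.pi * r ^ 2) * ‖g z‖ ^ 2) ≤ ENNReal.ofReal (N ^ 2) := by
    refine le_trans (le_of_eq ?_) ((mul_le_mul_right h1 (ENNReal.ofReal (r ^ α))).trans h2)
    rw [volume_ball_complex _ hr0.le, ENNReal.ofReal_mul (by positivity),
      ENNReal.ofReal_mul (by positivity), ENNReal.ofReal_pow (norm_nonneg _), ofReal_norm, mul_assoc]
  rw [ENNReal.ofReal_le_ofReal_iff (by positivity)] at h3
  have h4 : r ^ (2 + α) * ‖g z‖ ^ 2 ≤ N ^ 2 := by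
    refine le_trans ?_ h3
    rw [Real.rpow_add hr0, Real.rpow_two]
    gcongr ?_ * _
    have : 0 ≤ r ^ α * r ^ 2 := by positivity
    nlinarith [Real.pi_gt_three]
  have h5 : r ^ (1 + α / 2) * ‖g z‖ ≤ N := by
    refine le_of_sq_le_sq ?_ hN
    rw [mul_pow, ← Real.rpow_mul_natCast hr0.le]
    rwa [show (1 + α / 2) * ((2 : ℕ) : ℝ) = 2 + α by push_cast; ring]
  rw [Real.rpow_neg hr0.le, inv_mul_eq_div, le_div_iff₀ (by positivity), mul_comm]
  exact h5

lemma differentiableOn_deriv {f : ℂ → ℂ} (hf : DifferentiableOn ℂ f (ball 0 1)) :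
    DifferentiableOn ℂ (deriv f) (ball 0 1) := hf.deriv isOpen_ball

lemma lintegral_deriv_le {α : ℝ} {f : ℂ → ℂ} :
    ∫⁻ z, ‖deriv f z‖ₑ ^ 2 ∂diskMeasure α ≤ sqNorm α f := le_add_self

lemma norm_zero_le {α : ℝ} {f : ℂ → ℂ} : ‖f 0‖ ≤ norm α f := by
  refine Real.le_sqrt_of_sq_le ?_
  have : 0 ≤ ∫ z in ball (0 : ℂ) 1, energyDensity α f z :=
    setIntegral_nonneg measurableSet_ball fun z hz => energyDensity_nonneg hz
  linarith

lemma norm_deriv_le {α : ℝ} (hα : 0 ≤ α) {f : ℂ → ℂ} (hf : f ∈ Space α) {z : ℂ}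
    (hz : z ∈ ball (0 : ℂ) 1) :
    ‖deriv f z‖ ≤ 2 ^ (1 + α / 2) * norm α f * (1 - ‖z‖) ^ (-(1 + α / 2)) := by
  have hz1 : ‖z‖ < 1 := by simpa using hz
  have h := norm_le_of_lintegral_sq_le hα (norm_nonneg' α f) (differentiableOn_deriv hf.1)
    (lintegral_deriv_le.trans (sqNorm_eq hf).le) hz
  refine h.trans (le_of_eq ?_)
  rw [Real.div_rpow (by linarith) (by norm_num), Real.rpow_neg (by norm_num : (0 : ℝ) ≤ 2)]
  field_simp

/-- The constant in the growth estimate for functions in `D_α`. -/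
noncomputable def growthConst (α : ℝ) : ℝ := 1 + 2 ^ (1 + α / 2) * (2 / α)

lemma growthConst_pos {α : ℝ} (hα : 0 < α) : 0 < growthConst α := by
  unfold growthConst; positivity

/-- Integrates the derivative bound along the radius, in the form of a comparison with an explicit
antiderivative of the bound. Since `α > 0`, integration lowers the exponent `1 + α / 2` to `α / 2`.
-/
lemma norm_le {α : ℝ} (hα : 0 < α) {f : ℂ → ℂ} (hf : f ∈ Space α) {z : ℂ}
    (hz : z ∈ ball (0 : ℂ) 1) :
    ‖f z‖ ≤ growthConst α * norm α f * (1 - ‖z‖) ^ (-(α / 2)) := by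
  have hz1 : ‖z‖ < 1 := by simpa using hz
  have hN := norm_nonneg' α f
  have hpos : ∀ t ∈ Set.Icc (0 : ℝ) 1, 0 < 1 - t * ‖z‖ := fun t ht => by
    nlinarith [norm_nonneg z, ht.1, ht.2]
  have hmem : ∀ t ∈ Set.Icc (0 : ℝ) 1, (t : ℂ) * z ∈ ball (0 : ℂ) 1 := fun t ht => by
    have := hpos t ht
    rw [mem_ball_zero_iff, norm_mul, Complex.norm_real, Real.norm_of_nonneg ht.1]
    linarith
  have hder : ∀ t ∈ Set.Icc (0 : ℝ) 1, HasDerivAt (fun t : ℝ => f (t * z))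
      (deriv f (t * z) * z) t := fun t ht => by
    have h1 := (hf.1.differentiableAt (isOpen_ball.mem_nhds (hmem t ht))).hasDerivAt
    have h2 : HasDerivAt (fun t : ℝ => (t : ℂ) * z) z t := by
      simpa using (Complex.ofRealCLM.hasDerivAt (x := t)).mul_const z
    exact h1.comp t h2
  set K := 2 ^ (1 + α / 2) * norm α f with hK
  have hK0 : 0 ≤ K := by positivity
  have hB : ∀ t ∈ Set.Icc (0 : ℝ) 1, HasDerivAt
      (fun t : ℝ => norm α f + K * (2 / α) * (1 - t * ‖z‖) ^ (-(α / 2)))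
      (K * ‖z‖ * (1 - t * ‖z‖) ^ (-(1 + α / 2))) t := fun t ht => by
    have h1 : HasDerivAt (fun t : ℝ => 1 - t * ‖z‖) (-‖z‖) t := by
      simpa using ((hasDerivAt_id t).mul_const ‖z‖).const_sub 1
    have h2 := ((h1.rpow_const (p := -(α / 2)) (Or.inl (hpos t ht).ne')).const_mul
      (K * (2 / α))).const_add (norm α f)
    refine h2.congr_deriv ?_
    rw [show -(α / 2) - 1 = -(1 + α / 2) by ring]
    field_simp
  have h := image_norm_le_of_norm_deriv_right_le_deriv_boundary' (f := fun t : ℝ => f (t * z))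
    (f' := fun t => deriv f (t * z) * z) (a := 0) (b := 1)
    (B := fun t : ℝ => norm α f + K * (2 / α) * (1 - t * ‖z‖) ^ (-(α / 2)))
    (B' := fun t => K * ‖z‖ * (1 - t * ‖z‖) ^ (-(1 + α / 2)))
    (fun t ht => (hder t ht).continuousAt.continuousWithinAt)
    (fun t ht => (hder t (Set.Ico_subset_Icc_self ht)).hasDerivWithinAt)
    (by
      have : 0 ≤ K * (2 / α) := by positivity
      have := norm_zero_le (α := α) (f := f)
      simp
      linarith)
    (fun t ht => (hB t ht).continuousAt.continuousWithinAt)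
    (fun t ht => (hB t (Set.Ico_subset_Icc_self ht)).hasDerivWithinAt)
    (fun t ht => by
      have h1 := norm_deriv_le hα.le hf (hmem t (Set.Ico_subset_Icc_self ht))
      rw [norm_mul (t : ℂ), Complex.norm_real, Real.norm_of_nonneg ht.1] at h1
      rw [norm_mul]
      calc _ ≤ K * (1 - t * ‖z‖) ^ (-(1 + α / 2)) * ‖z‖ := by gcongr
        _ = _ := by ring) (Set.right_mem_Icc.2 zero_le_one)
  simp only [Complex.ofReal_one, one_mul] at h
  refine h.trans ?_
  have h1 : 1 ≤ (1 - ‖z‖) ^ (-(α / 2)) :=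
    Real.one_le_rpow_of_pos_of_le_one_of_nonpos (by linarith) (by linarith [norm_nonneg z])
      (by linarith)
  rw [growthConst, hK]
  nlinarith [mul_le_mul_of_nonneg_left h1 hN]

lemma enorm_sq_le_of_norm_le {α : ℝ} {f : ℂ → ℂ} (hf : f ∈ Space α) {x : ℂ} {c : ℝ}
    (h : ‖x‖ ≤ c * norm α f) : ‖x‖ₑ ^ 2 ≤ ENNReal.ofReal (c ^ 2) * sqNorm α f := by
  rw [sqNorm_eq hf, ← ENNReal.ofReal_mul (by positivity), ← mul_pow, ← ofReal_norm,
    ← ENNReal.ofReal_pow (norm_nonneg _)]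
  exact ENNReal.ofReal_le_ofReal (pow_le_pow_left₀ (norm_nonneg _) h 2)

/-! ### Hardy's inequality at the boundary point `1`. -/

lemma exists_lintegral_deriv_rpow_neg_le {α : ℝ} (hα₀ : 0 < α) (hα₂ : α < 2) :
    ∃ C : ℝ≥0∞, C ≠ ∞ ∧ ∀ f ∈ Space α,
      ∫⁻ u in ball (0 : ℂ) 1, ENNReal.ofReal ((1 - ‖u‖) ^ α * ‖u‖ ^ (-α)) * ‖deriv f u‖ₑ ^ 2 ≤
        C * sqNorm α f := by
  have hI := lintegral_ball_rpow_lt_top (γ := -α) (by linarith) 1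
  set I := ∫⁻ z in ball (0 : ℂ) 1, ENNReal.ofReal (‖z‖ ^ (-α))
  set K := ENNReal.ofReal ((2 ^ (1 + α / 2) * (1 / 2) ^ (-(1 + α / 2))) ^ 2)
  refine ⟨ENNReal.ofReal (2 ^ α) + K * I, by finiteness, fun f hf => ?_⟩
  have hd : Measurable (deriv f) := measurable_deriv f
  calc _ ≤ ∫⁻ u in ball (0 : ℂ) 1, (ENNReal.ofReal (2 ^ α) *
          (ENNReal.ofReal ((1 - ‖u‖) ^ α) * ‖deriv f u‖ₑ ^ 2) +
          K * sqNorm α f * ENNReal.ofReal (‖u‖ ^ (-α))) := by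
        refine lintegral_mono_ae ?_
        filter_upwards [ae_restrict_mem measurableSet_ball] with u hu
        have hu1 : ‖u‖ < 1 := by simpa using hu
        -- The extra factor `|u| ^ (-α)` is bounded away from the origin; near the origin `f'` is
        -- bounded by the norm and the factor is integrable because `α < 2`.
        rcases le_or_gt (1 / 2) ‖u‖ with h | h
        · refine le_add_right ?_
          rw [← mul_assoc, ← ENNReal.ofReal_mul (by positivity), mul_comm (2 ^ α)]
          gcongr
          refine (Real.rpow_le_rpow_of_nonpos (by norm_num) h (by linarith)).trans (le_of_eq ?_)
          rw [Real.rpow_neg (by norm_num), ← Real.inv_rpow (by norm_num)]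
          norm_num
        · refine le_add_left ?_
          rw [mul_comm]
          gcongr
          · refine enorm_sq_le_of_norm_le hf ((norm_deriv_le hα₀.le hf hu).trans ?_)
            rw [mul_right_comm]
            have hN := norm_nonneg' α f
            gcongr _ * ?_ * _
            exact Real.rpow_le_rpow_of_nonpos (by norm_num) (by linarith) (by linarith)
          · refine mul_le_of_le_one_left (by positivity)
              (Real.rpow_le_one (by linarith) (by linarith [norm_nonneg u]) hα₀.le)
    _ = ENNReal.ofReal (2 ^ α) * ∫⁻ z, ‖deriv f z‖ₑ ^ 2 ∂diskMeasure α +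
          K * sqNorm α f * I := by
        rw [lintegral_add_right _ (by fun_prop), lintegral_const_mul _ (by fun_prop),
          lintegral_const_mul _ (by fun_prop), lintegral_diskMeasure]
    _ ≤ ENNReal.ofReal (2 ^ α) * sqNorm α f + K * sqNorm α f * I := by
        gcongr; exact lintegral_deriv_le
    _ = _ := by ring

section cesaroFlow

lemma le_norm_one_sub_mul {q : ℝ} (hq : q ∈ Set.Icc (0 : ℝ) 1) (z : ℂ) :
    1 - (1 - q) * ‖z‖ ≤ ‖1 - (1 - (q : ℂ)) * z‖ := by
  have h1 := norm_sub_norm_le (1 : ℂ) ((1 - (q : ℂ)) * z)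
  have h2 : ‖(1 - (q : ℂ))‖ = 1 - q := by
    rw [← Complex.ofReal_one, ← Complex.ofReal_sub, Complex.norm_real,
      Real.norm_of_nonneg (by linarith [hq.2])]
  rw [norm_mul, h2, norm_one] at h1
  exact h1

lemma one_sub_mul_pos {q : ℝ} (hq : q ∈ Set.Icc (0 : ℝ) 1) {z : ℂ} (hz : ‖z‖ < 1) :
    0 < ‖1 - (1 - (q : ℂ)) * z‖ := by
  have := le_norm_one_sub_mul hq z
  nlinarith [norm_nonneg z, hq.1, hq.2]

/-- Multiplied out, this is the reverse triangle inequality for `1 - (1 - q) z`. It yields both that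
the flow preserves the disc and how the weight changes along it. -/
lemma cesaroFlow_bound {q : ℝ} (hq : q ∈ Set.Icc (0 : ℝ) 1) {z : ℂ} (hz : ‖z‖ < 1) :
    (1 - ‖z‖) ≤ (1 - ‖q * z / (1 - (1 - (q : ℂ)) * z)‖) * ‖1 - (1 - (q : ℂ)) * z‖ := by
  have h0 := one_sub_mul_pos hq hz
  have := le_norm_one_sub_mul hq z
  rw [norm_div, norm_mul, Complex.norm_real, Real.norm_of_nonneg hq.1, sub_mul,
    div_mul_cancel₀ _ h0.ne']
  linarith

lemma norm_cesaroFlow_lt {q : ℝ} (hq : q ∈ Set.Icc (0 : ℝ) 1) {z : ℂ} (hz : ‖z‖ < 1) :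
    ‖q * z / (1 - (1 - (q : ℂ)) * z)‖ < 1 := by
  have h0 := one_sub_mul_pos hq hz
  have := cesaroFlow_bound hq hz
  by_contra! h
  nlinarith

lemma hasDerivAt_cesaroFlow {q : ℝ} (hq : q ∈ Set.Icc (0 : ℝ) 1) {z : ℂ} (hz : ‖z‖ < 1) :
    HasDerivAt (fun z => q * z / (1 - (1 - (q : ℂ)) * z)) (q / (1 - (1 - (q : ℂ)) * z) ^ 2) z := by
  have h0 : 1 - (1 - (q : ℂ)) * z ≠ 0 := norm_pos_iff.1 (one_sub_mul_pos hq hz)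
  have h := ((hasDerivAt_id z).const_mul (q : ℂ)).div
    (((hasDerivAt_id z).const_mul (1 - (q : ℂ))).const_sub 1) h0
  refine h.congr_deriv ?_
  simp only [id]
  field_simp
  ring

/-- The factor `1 - z` in the velocity is the reason for choosing this flow: it cancels the
denominator in Hardy's inequality. -/
lemma hasDerivAt_cesaroFlow_param {q : ℝ} (hq : q ∈ Set.Icc (0 : ℝ) 1) {z : ℂ} (hz : ‖z‖ < 1) :
    HasDerivAt (fun q : ℝ => q * z / (1 - (1 - (q : ℂ)) * z))
      (z * (1 - z) / (1 - (1 - (q : ℂ)) * z) ^ 2) q := by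
  have h0 : 1 - (1 - (q : ℂ)) * z ≠ 0 := norm_pos_iff.1 (one_sub_mul_pos hq hz)
  have hid := Complex.ofRealCLM.hasDerivAt (x := q)
  have h := (hid.mul_const z).div (((hid.const_sub 1).mul_const z).const_sub 1) h0
  refine h.congr_deriv ?_
  simp only [Complex.ofRealCLM_apply, Complex.ofReal_one]
  field_simp
  ring

lemma injOn_cesaroFlow {q : ℝ} (hq : q ∈ Set.Ioo (0 : ℝ) 1) :
    Set.InjOn (fun z => q * z / (1 - (1 - (q : ℂ)) * z)) (ball 0 1) := by
  intro z hz w hw h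
  have hz0 : 1 - (1 - (q : ℂ)) * z ≠ 0 :=
    norm_pos_iff.1 (one_sub_mul_pos ⟨hq.1.le, hq.2.le⟩ (by simpa using hz))
  have hw0 : 1 - (1 - (q : ℂ)) * w ≠ 0 :=
    norm_pos_iff.1 (one_sub_mul_pos ⟨hq.1.le, hq.2.le⟩ (by simpa using hw))
  have hq0 : (q : ℂ) ≠ 0 := by exact_mod_cast hq.1.ne'
  simp only at h
  rw [div_eq_div_iff hz0 hw0] at h
  have : (q : ℂ) * (z - w) = 0 := by linear_combination h
  simpa [hq0, sub_eq_zero] using this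

/-- With `A = |1 - (1 - q) z| = q |z| / |φ z|`, one has `A ≤ q / |φ z|`, so the weight at `z` is at
most `q ^ α |φ z| ^ (-α)` times the weight at `φ z`. Creating the Jacobian `|φ'|² = q² / A⁴` costs
`q ^ (-2)`, for a total of `q ^ (α - 2)`. -/
lemma lintegral_cesaroFlow_le {α : ℝ} (hα : 0 < α) {q : ℝ} (hq : q ∈ Set.Ioo (0 : ℝ) 1)
    (f : ℂ → ℂ) :
    ∫⁻ z, ‖deriv f (q * z / (1 - (1 - (q : ℂ)) * z)) / (1 - (1 - (q : ℂ)) * z) ^ 2‖ₑ ^ 2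
        ∂diskMeasure α ≤
      (∫⁻ u in ball (0 : ℂ) 1,
        ENNReal.ofReal ((1 - ‖u‖) ^ α * ‖u‖ ^ (-α)) * ‖deriv f u‖ₑ ^ 2) *
        ENNReal.ofReal (q ^ (-(2 * (1 - α / 2)))) := by
  have hq' : q ∈ Set.Icc (0 : ℝ) 1 := ⟨hq.1.le, hq.2.le⟩
  have hq0 := hq.1
  set g : ℂ → ℝ≥0∞ := fun u => ENNReal.ofReal ((1 - ‖u‖) ^ α * ‖u‖ ^ (-α)) * ‖deriv f u‖ₑ ^ 2
    with hg
  set φ : ℂ → ℂ := fun z => q * z / (1 - (1 - (q : ℂ)) * z) with hφ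
  have hmem : ∀ {z : ℂ}, z ∈ ball (0 : ℂ) 1 → ‖z‖ < 1 := fun h => by simpa using h
  have hchange := lintegral_comp_mul_deriv_sq_le (φ := φ) isOpen_ball
    (fun z hz => (hasDerivAt_cesaroFlow hq' (hmem hz)).differentiableAt.differentiableWithinAt)
    (injOn_cesaroFlow hq) (V := ball 0 1)
    (fun z hz => by rw [mem_ball_zero_iff]; exact norm_cesaroFlow_lt hq' (hmem hz)) g
  rw [mul_comm]
  refine le_trans ?_ (mul_le_mul_right hchange _)
  rw [lintegral_diskMeasure, ← lintegral_const_mul' _ _ ENNReal.ofReal_ne_top]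
  refine lintegral_mono_ae ?_
  -- The origin must be discarded: the flow fixes it, and there `‖φ z‖ ^ (-α)` takes the default
  -- value `0`.
  have hne : ∀ᵐ z ∂(volume.restrict (ball (0 : ℂ) 1)), z ≠ 0 :=
    ae_restrict_of_ae (by simp [ae_iff])
  filter_upwards [ae_restrict_mem measurableSet_ball, hne] with z hz hz0
  have hz1 := hmem hz
  have h0 := one_sub_mul_pos hq' hz1
  have hb := cesaroFlow_bound hq' hz1
  have hlt := norm_cesaroFlow_lt hq' hz1
  have hd : deriv φ z = q / (1 - (1 - (q : ℂ)) * z) ^ 2 := (hasDerivAt_cesaroFlow hq' hz1).deriv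
  have hφn : ‖φ z‖ = q * ‖z‖ / ‖1 - (1 - (q : ℂ)) * z‖ := by
    rw [hφ, norm_div, norm_mul, Complex.norm_real, Real.norm_of_nonneg hq0.le]
  rw [hd, hg]
  simp only
  have hφe : q * z / (1 - (1 - (q : ℂ)) * z) = φ z := rfl
  rw [hφe] at hb hlt ⊢
  set A := ‖1 - (1 - (q : ℂ)) * z‖ with hA
  have hzpos : 0 < ‖z‖ := norm_pos_iff.2 hz0
  have hφpos : 0 < ‖φ z‖ := by rw [hφn]; positivity
  have hAle : A ≤ q / ‖φ z‖ := by
    rw [hφn, div_div_eq_mul_div, le_div_iff₀ (by positivity)]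
    have := mul_le_mul_of_nonneg_left hz1.le (by positivity : 0 ≤ q * A)
    nlinarith
  have hkey : (1 - ‖z‖) ^ α ≤ q ^ α * ((1 - ‖φ z‖) ^ α * ‖φ z‖ ^ (-α)) := by
    calc (1 - ‖z‖) ^ α ≤ ((1 - ‖φ z‖) * (q / ‖φ z‖)) ^ α := by
          refine Real.rpow_le_rpow (by linarith) (hb.trans ?_) hα.le
          exact mul_le_mul_of_nonneg_left hAle (by linarith)
      _ = _ := by
          rw [Real.mul_rpow (by linarith) (by positivity), Real.div_rpow hq0.le hφpos.le,
            Real.rpow_neg hφpos.le]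
          ring
  have e1 : ∀ x : ℂ, ‖x‖ₑ ^ 2 = ENNReal.ofReal (‖x‖ ^ 2) := fun x => by
    rw [ENNReal.ofReal_pow (norm_nonneg _), ofReal_norm]
  simp only [e1]
  have hw0 : 0 ≤ (1 - ‖φ z‖) ^ α * ‖φ z‖ ^ (-α) :=
    mul_nonneg (Real.rpow_nonneg (by linarith) _) (by positivity)
  rw [← ENNReal.ofReal_mul (Real.rpow_nonneg (by linarith) _), ← ENNReal.ofReal_mul hw0,
    ← ENNReal.ofReal_mul (by positivity), ← ENNReal.ofReal_mul (by positivity)]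
  refine ENNReal.ofReal_le_ofReal ?_
  rw [norm_div, norm_div, norm_pow, Complex.norm_real, Real.norm_of_nonneg hq0.le, ← hA]
  have hqq : q ^ (-(2 * (1 - α / 2))) * q ^ 2 = q ^ α := by
    rw [← Real.rpow_two, ← Real.rpow_add hq0]; ring_nf
  calc (1 - ‖z‖) ^ α * (‖deriv f (φ z)‖ / A ^ 2) ^ 2
      ≤ q ^ α * ((1 - ‖φ z‖) ^ α * ‖φ z‖ ^ (-α)) * (‖deriv f (φ z)‖ / A ^ 2) ^ 2 := by gcongr
    _ = _ := by rw [← hqq]; field_simp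

lemma enorm_sub_zero_le {α : ℝ} {f : ℂ → ℂ} (hf : f ∈ Space α) {z : ℂ}
    (hz : z ∈ ball (0 : ℂ) 1) :
    ‖(f z - f 0) / (1 - z)‖ₑ ≤ ∫⁻ q in Set.Ioo (0 : ℝ) 1,
      ‖deriv f (q * z / (1 - (1 - (q : ℂ)) * z)) / (1 - (1 - (q : ℂ)) * z) ^ 2‖ₑ := by
  have hz1 : ‖z‖ < 1 := by simpa using hz
  have hne : 1 - z ≠ 0 := by
    intro h
    rw [← sub_eq_zero.1 h] at hz1
    simp at hz1
  set F : ℝ → ℂ := fun q =>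
    deriv f (q * z / (1 - (1 - (q : ℂ)) * z)) / (1 - (1 - (q : ℂ)) * z) ^ 2 with hF
  have hcont : ContinuousOn F (Set.Icc 0 1) := by
    have h1 : ∀ q ∈ Set.Icc (0 : ℝ) 1, 1 - (1 - (q : ℂ)) * z ≠ 0 := fun q hq =>
      norm_pos_iff.1 (one_sub_mul_pos hq hz1)
    refine ContinuousOn.div ((differentiableOn_deriv hf.1).continuousOn.comp
      (ContinuousOn.div (by fun_prop) (by fun_prop) h1) fun q hq => ?_) (by fun_prop)
      fun q hq => pow_ne_zero 2 (h1 q hq)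
    rw [mem_ball_zero_iff]; exact norm_cesaroFlow_lt hq hz1
  have hint : ∫ q in (0 : ℝ)..1, z * (1 - z) * F q = f z - f 0 := by
    rw [intervalIntegral.integral_eq_sub_of_hasDerivAt
      (f := fun q : ℝ => f (q * z / (1 - (1 - (q : ℂ)) * z)))]
    · simp
    · intro q hq
      rw [Set.uIcc_of_le zero_le_one] at hq
      have h1 := (hf.1.differentiableAt (isOpen_ball.mem_nhds (mem_ball_zero_iff.2
        (norm_cesaroFlow_lt hq hz1)))).hasDerivAt.comp q (hasDerivAt_cesaroFlow_param hq hz1)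
      refine h1.congr_deriv ?_
      rw [hF]; ring
    · refine ContinuousOn.intervalIntegrable ?_
      rw [Set.uIcc_of_le zero_le_one]
      exact continuousOn_const.mul hcont
  rw [intervalIntegral.integral_const_mul, intervalIntegral.integral_of_le zero_le_one,
    integral_Ioc_eq_integral_Ioo] at hint
  rw [← hint, mul_comm z, mul_assoc, mul_div_cancel_left₀ _ hne, enorm_mul]
  calc _ ≤ 1 * ‖∫ q in Set.Ioo (0 : ℝ) 1, F q‖ₑ := by
        gcongr
        rw [← ofReal_norm]; exact ENNReal.ofReal_le_one.2 hz1.le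
    _ ≤ _ := by rw [one_mul]; exact enorm_integral_le_lintegral_enorm _

end cesaroFlow

lemma lintegral_one_sub_rpow_lt_top {γ : ℝ} (hγ : -2 < γ) :
    ∫⁻ z in ball (0 : ℂ) 1, ENNReal.ofReal (‖1 - z‖ ^ γ) < ∞ := by
  -- Translation to the centre `1`; radius `2` is enough to contain the unit disc.
  have h := lintegral_ball_rotate 1 2 0 fun z => ENNReal.ofReal (‖1 - z‖ ^ γ)
  simp only [circleMap_zero, Complex.ofReal_one, Complex.ofReal_zero, zero_mul, Complex.exp_zero,
    mul_one, one_mul, sub_add_cancel_left, norm_neg] at h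
  refine (lintegral_mono_set ?_).trans_lt (h ▸ lintegral_ball_rpow_lt_top hγ 2)
  exact ball_subset_ball' (by simp; norm_num)

lemma one_sub_norm_le (z : ℂ) : 1 - ‖z‖ ≤ ‖1 - z‖ := by
  simpa using norm_sub_norm_le (1 : ℂ) z

lemma one_sub_ne_zero {z : ℂ} (hz : z ∈ ball (0 : ℂ) 1) : 1 - z ≠ 0 := by
  have hz1 : ‖z‖ < 1 := by simpa using hz
  intro h
  rw [← sub_eq_zero.1 h] at hz1
  simp at hz1

/-- Because `1 - |z| ≤ |1 - z|`, the integrand is at most `|1 - z| ^ (α - 2)`. This handles the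
constant term `f 0` in Hardy's inequality. -/
lemma lintegral_inv_one_sub_sq_lt_top {α : ℝ} (hα : 0 < α) :
    ∫⁻ z, ‖(1 - z)⁻¹‖ₑ ^ 2 ∂diskMeasure α < ∞ := by
  refine lt_of_le_of_lt ?_ (lintegral_one_sub_rpow_lt_top (γ := α - 2) (by linarith))
  rw [lintegral_diskMeasure]
  refine lintegral_mono_ae ?_
  filter_upwards [ae_restrict_mem measurableSet_ball] with z hz
  have hz1 : ‖z‖ < 1 := by simpa using hz
  have h0 : 0 < ‖1 - z‖ := norm_pos_iff.2 (one_sub_ne_zero hz)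
  rw [← ofReal_norm, ← ENNReal.ofReal_pow (norm_nonneg _),
    ← ENNReal.ofReal_mul (Real.rpow_nonneg (by linarith) _)]
  refine ENNReal.ofReal_le_ofReal ?_
  rw [Real.rpow_sub h0, Real.rpow_two, norm_inv, inv_pow, div_eq_mul_inv]
  gcongr
  exact one_sub_norm_le z

/-- Hardy's inequality at the boundary point `1`. -/
lemma exists_lintegral_div_one_sub_le {α : ℝ} (hα₀ : 0 < α) (hα₂ : α < 2) :
    ∃ C : ℝ≥0∞, C ≠ ∞ ∧ ∀ f ∈ Space α,
      ∫⁻ z, ‖f z / (1 - z)‖ₑ ^ 2 ∂diskMeasure α ≤ C * sqNorm α f := by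
  obtain ⟨C, hC, h⟩ := exists_lintegral_deriv_rpow_neg_le hα₀ hα₂
  have hI := lintegral_inv_one_sub_sq_lt_top hα₀
  set I := ∫⁻ z, ‖(1 - z)⁻¹‖ₑ ^ 2 ∂diskMeasure α
  set K := ENNReal.ofReal (1 / (1 - (1 - α / 2))) ^ 2
  refine ⟨2 * (K * C) + 2 * I, by finiteness, fun f hf => ?_⟩
  set G : ℝ → ℂ → ℂ := fun q z =>
    deriv f (q * z / (1 - (1 - (q : ℂ)) * z)) / (1 - (1 - (q : ℂ)) * z) ^ 2 with hG
  have hmeas : AEMeasurable (Function.uncurry fun q z => ‖G q z‖ₑ)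
      ((volume.restrict (Set.Ioo 0 1)).prod (diskMeasure α)) := by
    refine (aemeasurable_prod_diskMeasure (F := fun x => G x.1 x.2) α measurableSet_Ioo ?_).enorm
    have hmem : ∀ x ∈ Set.Ioo (0 : ℝ) 1 ×ˢ ball (0 : ℂ) 1,
        x.1 ∈ Set.Icc (0 : ℝ) 1 ∧ ‖x.2‖ < 1 := fun x hx =>
      ⟨⟨hx.1.1.le, hx.1.2.le⟩, by simpa using hx.2⟩
    have h1 : ∀ x ∈ Set.Ioo (0 : ℝ) 1 ×ˢ ball (0 : ℂ) 1, 1 - (1 - (x.1 : ℂ)) * x.2 ≠ 0 :=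
      fun x hx => norm_pos_iff.1 (one_sub_mul_pos (hmem x hx).1 (hmem x hx).2)
    refine ContinuousOn.div ((differentiableOn_deriv hf.1).continuousOn.comp
      (ContinuousOn.div (by fun_prop) (by fun_prop) h1) fun x hx => ?_) (by fun_prop)
      fun q hq => pow_ne_zero 2 (h1 q hq)
    rw [mem_ball_zero_iff]; exact norm_cesaroFlow_lt (hmem x hx).1 (hmem x hx).2
  have hmink := lintegral_sq_lintegral_Ioo_le (a := 1 - α / 2) (by linarith) hmeas
    fun q hq => lintegral_cesaroFlow_le hα₀ hq f
  calc _ ≤ ∫⁻ z, (2 * (∫⁻ q in Set.Ioo (0 : ℝ) 1, ‖G q z‖ₑ) ^ 2 +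
          2 * ‖f 0‖ₑ ^ 2 * ‖(1 - z)⁻¹‖ₑ ^ 2) ∂diskMeasure α := by
        refine lintegral_diskMeasure_mono fun z hz => ?_
        have e : f z / (1 - z) = (f z - f 0) / (1 - z) + f 0 * (1 - z)⁻¹ := by ring
        calc _ ≤ (‖(f z - f 0) / (1 - z)‖ₑ + ‖f 0 * (1 - z)⁻¹‖ₑ) ^ 2 := by
              rw [e]; gcongr; exact enorm_add_le _ _
          _ ≤ _ := add_sq_le_two_mul _ _
          _ ≤ _ := by
              rw [enorm_mul, mul_pow, ← mul_assoc]
              gcongr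
              exact enorm_sub_zero_le hf hz
    _ = 2 * (∫⁻ z, (∫⁻ q in Set.Ioo (0 : ℝ) 1, ‖G q z‖ₑ) ^ 2 ∂diskMeasure α) +
          2 * ‖f 0‖ₑ ^ 2 * I := by
        rw [lintegral_add_right _ (by fun_prop), lintegral_const_mul' _ _ (by simp),
          lintegral_const_mul _ (by fun_prop)]
    _ ≤ 2 * (K * (C * sqNorm α f)) + 2 * sqNorm α f * I := by
        gcongr
        · exact hmink.trans (by gcongr; exact h f hf)
        · exact le_self_add
    _ = _ := by ring

/-! ### Means over segments. -/

/-- Differentiation under the integral sign for a holomorphic family with an integrable bound that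
is locally uniform in the disc. -/
lemma hasDerivAt_setIntegral_of_norm_le {F F' : ℝ → ℂ → ℂ}
    (hF : ∀ z ∈ ball (0 : ℂ) 1, ContinuousOn (fun t => F t z) (Set.Ioo 0 1))
    (hF' : ∀ z ∈ ball (0 : ℂ) 1, ContinuousOn (fun t => F' t z) (Set.Ioo 0 1))
    (hd : ∀ t ∈ Set.Ioo (0 : ℝ) 1, ∀ z ∈ ball (0 : ℂ) 1, HasDerivAt (F t) (F' t z) z)
    (hb : ∀ r < 1, ∃ b : ℝ → ℝ, IntegrableOn b (Set.Ioo 0 1) ∧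
      ∀ t ∈ Set.Ioo (0 : ℝ) 1, ∀ z : ℂ, ‖z‖ ≤ r → ‖F t z‖ ≤ b t)
    {z : ℂ} (hz : z ∈ ball (0 : ℂ) 1) :
    IntegrableOn (fun t => F t z) (Set.Ioo 0 1) ∧ IntegrableOn (fun t => F' t z) (Set.Ioo 0 1) ∧
      HasDerivAt (fun w => ∫ t in Set.Ioo (0 : ℝ) 1, F t w) (∫ t in Set.Ioo (0 : ℝ) 1, F' t z) z := by
  have hz1 : ‖z‖ < 1 := by simpa using hz
  -- A quarter of the distance leaves room for two steps of length `δ`: one to move `z`, one for the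
  -- Cauchy circle.
  set δ := (1 - ‖z‖) / 4 with hδ
  have hδ0 : 0 < δ := by linarith
  obtain ⟨b, hbi, hb⟩ := hb (‖z‖ + 2 * δ) (by linarith)
  have hm : ∀ w ∈ ball (0 : ℂ) 1,
      AEStronglyMeasurable (fun t => F t w) (volume.restrict (Set.Ioo 0 1)) := fun w hw =>
    (hF w hw).aestronglyMeasurable measurableSet_Ioo
  have hint : IntegrableOn (fun t => F t z) (Set.Ioo 0 1) :=
    Integrable.mono' hbi (hm z hz) ((ae_restrict_mem measurableSet_Ioo).mono fun t ht =>
      hb t ht z (by linarith))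
  have hsub : ∀ w ∈ ball z δ, closedBall w δ ⊆ ball 0 1 ∧ ∀ v ∈ closedBall w δ,
      ‖v‖ ≤ ‖z‖ + 2 * δ := fun w hw => by
    have h1 : ∀ v ∈ closedBall w δ, ‖v‖ ≤ ‖z‖ + 2 * δ := fun v hv => by
      rw [mem_ball, dist_eq_norm] at hw
      rw [mem_closedBall, dist_eq_norm] at hv
      have h2 := norm_le_norm_add_norm_sub' w z
      have h3 := norm_le_norm_add_norm_sub' v w
      linarith
    refine ⟨fun v hv => ?_, h1⟩
    have := h1 v hv
    rw [mem_ball_zero_iff]; linarith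
  refine ⟨hint, hasDerivAt_integral_of_dominated_loc_of_deriv_le (ball_mem_nhds z hδ0)
    (Filter.mem_of_superset (isOpen_ball.mem_nhds hz) hm) hint
    ((hF' z hz).aestronglyMeasurable measurableSet_Ioo)
    (F := fun w t => F t w) (F' := fun w t => F' t w) (bound := fun t => b t / δ) ?_ (hbi.div_const δ) ?_⟩
  · filter_upwards [ae_restrict_mem measurableSet_Ioo] with t ht w hw
    obtain ⟨h1, h2⟩ := hsub w hw
    rw [← (hd t ht w (h1 (mem_closedBall_self hδ0.le))).deriv]
    -- Cauchy's estimate turns the bound on `F` into a bound on its derivative, so only `F` has to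
    -- be dominated.
    refine Complex.norm_deriv_le_of_forall_mem_sphere_norm_le hδ0
      (DifferentiableOn.diffContOnCl_ball (U := ball 0 1)
        (fun v hv => (hd t ht v hv).differentiableAt.differentiableWithinAt) h1)
      fun v hv => hb t ht v (h2 v (sphere_subset_closedBall hv))
  · filter_upwards [ae_restrict_mem measurableSet_Ioo] with t ht w hw
    exact hd t ht w ((hsub w hw).1 (mem_closedBall_self hδ0.le))

/-- The mean of `g` over the segment from `p` to `z`. -/
noncomputable def segMean (p : ℂ) (g : ℂ → ℂ) (z : ℂ) : ℂ :=
  ∫ t in Set.Ioo (0 : ℝ) 1, g (p + t * (z - p))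

lemma mul_one_sub_norm_le {p z : ℂ} (hp : ‖p‖ ≤ 1) {t : ℝ} (ht : t ∈ Set.Icc (0 : ℝ) 1) :
    t * (1 - ‖z‖) ≤ 1 - ‖p + t * (z - p)‖ := by
  have h : ‖p + t * (z - p)‖ ≤ (1 - t) * 1 + t * ‖z‖ := by
    calc ‖p + t * (z - p)‖ = ‖((1 - t : ℝ) : ℂ) * p + (t : ℂ) * z‖ := by
          congr 1; push_cast; ring
      _ ≤ (1 - t) * ‖p‖ + t * ‖z‖ := by
          refine (norm_add_le _ _).trans (le_of_eq ?_)
          rw [norm_mul, norm_mul, Complex.norm_real, Complex.norm_real,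
            Real.norm_of_nonneg (by linarith [ht.2]), Real.norm_of_nonneg ht.1]
      _ ≤ _ := by
          gcongr
          linarith [ht.2]
  linarith

lemma seg_mem_ball {p z : ℂ} (hp : ‖p‖ ≤ 1) (hz : z ∈ ball (0 : ℂ) 1) {t : ℝ}
    (ht : t ∈ Set.Ioc (0 : ℝ) 1) : p + t * (z - p) ∈ ball (0 : ℂ) 1 := by
  have hz1 : ‖z‖ < 1 := by simpa using hz
  have := mul_one_sub_norm_le (z := z) hp ⟨ht.1.le, ht.2⟩
  rw [mem_ball_zero_iff]
  nlinarith [mul_pos ht.1 (sub_pos.2 hz1)]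

lemma hasDerivAt_seg_param (p z : ℂ) (t : ℝ) :
    HasDerivAt (fun t : ℝ => p + t * (z - p)) (z - p) t := by
  simpa using ((Complex.ofRealCLM.hasDerivAt (x := t)).mul_const (z - p)).const_add p

lemma hasDerivAt_seg (p : ℂ) (t : ℝ) (z : ℂ) :
    HasDerivAt (fun z : ℂ => p + t * (z - p)) t z := by
  simpa using (((hasDerivAt_id z).sub_const p).const_mul (t : ℂ)).const_add p

lemma integrableOn_Ioo_rpow {a : ℝ} (ha : a < 1) (K : ℝ) :
    IntegrableOn (fun t : ℝ => K * t ^ (-a)) (Set.Ioo 0 1) :=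
  Integrable.const_mul
    ((intervalIntegral.integrableOn_Ioo_rpow_iff zero_lt_one).2 (by linarith)) K

lemma continuousOn_seg {p z : ℂ} (hp : ‖p‖ ≤ 1) (hz : z ∈ ball (0 : ℂ) 1) {g : ℂ → ℂ}
    (hg : ContinuousOn g (ball 0 1)) :
    ContinuousOn (fun t : ℝ => g (p + t * (z - p))) (Set.Ioc 0 1) :=
  hg.comp (by fun_prop) fun _ ht => seg_mem_ball hp hz ht

/-- The growth condition under which segment means from `p` are well behaved. -/
def SegBound (p : ℂ) (g : ℂ → ℂ) : Prop :=
  ∀ r < 1, ∃ K a : ℝ, a < 1 ∧ ∀ t ∈ Set.Ioo (0 : ℝ) 1, ∀ z : ℂ, ‖z‖ ≤ r →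
    ‖g (p + t * (z - p))‖ ≤ K * t ^ (-a)

lemma segMean_hasDerivAt {p : ℂ} (hp : ‖p‖ ≤ 1) {g : ℂ → ℂ} (hg : DifferentiableOn ℂ g (ball 0 1))
    (hb : SegBound p g) {z : ℂ} (hz : z ∈ ball (0 : ℂ) 1) :
    IntegrableOn (fun t : ℝ => g (p + t * (z - p))) (Set.Ioo 0 1) ∧
    IntegrableOn (fun t : ℝ => (t : ℂ) * deriv g (p + t * (z - p))) (Set.Ioo 0 1) ∧
      HasDerivAt (segMean p g) (∫ t in Set.Ioo (0 : ℝ) 1, (t : ℂ) * deriv g (p + t * (z - p))) z := by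
  refine hasDerivAt_setIntegral_of_norm_le (F := fun t z => g (p + t * (z - p)))
    (F' := fun t z => (t : ℂ) * deriv g (p + t * (z - p)))
    (fun w hw => (continuousOn_seg hp hw hg.continuousOn).mono Set.Ioo_subset_Ioc_self)
    (fun w hw => ContinuousOn.mul (by fun_prop) ((continuousOn_seg hp hw
      (differentiableOn_deriv hg).continuousOn).mono Set.Ioo_subset_Ioc_self))
    (fun t ht w hw => ?_) (fun r hr => ?_) hz
  · have h1 := (hg.differentiableAt (isOpen_ball.mem_nhds
      (seg_mem_ball hp hw (Set.Ioo_subset_Ioc_self ht)))).hasDerivAt.comp w (hasDerivAt_seg p t w)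
    exact h1.congr_deriv (mul_comm _ _)
  · obtain ⟨K, a, ha, h⟩ := hb r hr
    exact ⟨_, integrableOn_Ioo_rpow ha K, h⟩

lemma differentiableOn_segMean {p : ℂ} (hp : ‖p‖ ≤ 1) {g : ℂ → ℂ}
    (hg : DifferentiableOn ℂ g (ball 0 1)) (hb : SegBound p g) :
    DifferentiableOn ℂ (segMean p g) (ball 0 1) := fun _ hz =>
  (segMean_hasDerivAt hp hg hb hz).2.2.differentiableAt.differentiableWithinAt

/-- The differential equation `(z - p) (M g)' = g - M g` of the segment mean. -/
lemma sub_mul_deriv_segMean {p : ℂ} (hp : ‖p‖ ≤ 1) {g : ℂ → ℂ}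
    (hg : DifferentiableOn ℂ g (ball 0 1)) (hb : SegBound p g) {z : ℂ} (hz : z ∈ ball (0 : ℂ) 1) :
    (z - p) * deriv (segMean p g) z = g z - segMean p g z := by
  have hz1 : ‖z‖ < 1 := by simpa using hz
  obtain ⟨hi, hi', hd⟩ := segMean_hasDerivAt hp hg hb hz
  rw [hd.deriv]
  -- The identity is the fundamental theorem of calculus for `t * g (p + t (z - p))`. At `t = 0` the
  -- point may be on the unit circle, but the growth exponent `a < 1` forces the product to tend to
  -- `0`, its value there whatever `g p` is.
  have hcont : ContinuousOn (fun t : ℝ => (t : ℂ) * g (p + t * (z - p))) (Set.Icc 0 1) := by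
    intro t ht
    rcases ht.1.eq_or_lt with rfl | h0
    · obtain ⟨K, a, ha, h⟩ := hb ‖z‖ hz1
      have hlim : Filter.Tendsto (fun t : ℝ => |K| * t ^ (1 - a)) (nhdsWithin 0 (Set.Icc 0 1))
          (nhds 0) := by
        have : ContinuousAt (fun t : ℝ => |K| * t ^ (1 - a)) 0 :=
          continuousAt_const.mul (Real.continuousAt_rpow_const _ _ (Or.inr (by linarith)))
        have := this.tendsto
        rw [Real.zero_rpow (by linarith), mul_zero] at this
        exact this.mono_left nhdsWithin_le_nhds
      rw [ContinuousWithinAt]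
      simp only [Complex.ofReal_zero, zero_mul]
      refine squeeze_zero_norm' ?_ hlim
      have h1 : Set.Iio (1 : ℝ) ∈ nhdsWithin 0 (Set.Icc (0 : ℝ) 1) :=
        nhdsWithin_le_nhds (Iio_mem_nhds zero_lt_one)
      filter_upwards [self_mem_nhdsWithin, h1] with t ht ht1
      rcases ht.1.eq_or_lt with rfl | h0
      · simp only [Complex.ofReal_zero, zero_mul, norm_zero]; positivity
      rw [norm_mul, Complex.norm_real, Real.norm_of_nonneg ht.1, sub_eq_add_neg 1 a,
        Real.rpow_add h0, Real.rpow_one]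
      calc _ ≤ t * (K * t ^ (-a)) := by gcongr; exact h t ⟨h0, ht1⟩ z le_rfl
        _ ≤ t * (|K| * t ^ (-a)) := by gcongr; exact le_abs_self K
        _ = _ := by ring
    · have h1 : p + t * (z - p) ∈ ball (0 : ℂ) 1 := seg_mem_ball hp hz ⟨h0, ht.2⟩
      have h2 : ContinuousAt (fun t : ℝ => g (p + t * (z - p))) t :=
        ContinuousAt.comp (f := fun t : ℝ => p + t * (z - p))
          (hg.differentiableAt (isOpen_ball.mem_nhds h1)).continuousAt (by fun_prop)
      exact (ContinuousAt.mul (by fun_prop) h2).continuousWithinAt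
  have h := intervalIntegral.integral_eq_sub_of_hasDerivAt_of_le zero_le_one hcont
    (f' := fun t : ℝ => g (p + t * (z - p)) + (z - p) * (t * deriv g (p + t * (z - p))))
    (fun t ht => by
      have h1 := (hg.differentiableAt (isOpen_ball.mem_nhds (seg_mem_ball hp hz
        (Set.Ioo_subset_Ioc_self ht)))).hasDerivAt.comp t (hasDerivAt_seg_param p z t)
      refine ((Complex.ofRealCLM.hasDerivAt (x := t)).mul h1).congr_deriv ?_
      simp only [Complex.ofRealCLM_apply, Complex.ofReal_one, Function.comp]
      ring)
    (by
      rw [intervalIntegrable_iff_integrableOn_Ioo_of_le zero_le_one]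
      exact hi.add (hi'.const_mul _))
  rw [intervalIntegral.integral_of_le zero_le_one, integral_Ioc_eq_integral_Ioo,
    integral_add hi (hi'.const_mul _), integral_const_mul] at h
  simp only [Complex.ofReal_one, one_mul, Complex.ofReal_zero, zero_mul, sub_zero,
    add_sub_cancel] at h
  rw [segMean, ← h]; ring

lemma sqNorm_congr {α : ℝ} {f g : ℂ → ℂ} (h : Set.EqOn f g (ball 0 1)) :
    sqNorm α f = sqNorm α g := by
  unfold sqNorm
  rw [h (mem_ball_self one_pos)]
  congr 1
  refine lintegral_congr_ae ((ae_diskMeasure_mem_ball α).mono fun z hz => ?_)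
  simp only
  rw [(h.eventuallyEq_of_mem (isOpen_ball.mem_nhds hz)).deriv_eq]

/-- The Jacobian of the contraction towards `p` contributes `t ^ (-2)`; the weight contributes `t ^
(-α)`, since the distance to the circle shrinks at most by the factor `t`. -/
lemma lintegral_comp_seg_le {α : ℝ} (hα : 0 ≤ α) {p : ℂ} (hp : ‖p‖ ≤ 1) {t : ℝ}
    (ht : t ∈ Set.Ioo (0 : ℝ) 1) (h : ℂ → ℝ≥0∞) :
    ∫⁻ z, h (p + t * (z - p)) ∂diskMeasure α ≤
      ENNReal.ofReal (t ^ (-(2 + α))) * ∫⁻ z, h z ∂diskMeasure α := by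
  have ht0 := ht.1
  have htc : (t : ℂ) ≠ 0 := by exact_mod_cast ht0.ne'
  have hc := lintegral_comp_mul_deriv_sq_le (φ := fun z : ℂ => p + t * (z - p)) isOpen_ball
    (fun z _ => (hasDerivAt_seg p t z).differentiableAt.differentiableWithinAt)
    (fun z _ w _ hzw => by simpa [htc] using hzw) (V := ball 0 1)
    (fun z hz => seg_mem_ball hp hz (Set.Ioo_subset_Ioc_self ht))
    (fun u => ENNReal.ofReal ((1 - ‖u‖) ^ α) * h u)
  rw [lintegral_diskMeasure, lintegral_diskMeasure]
  refine le_trans ?_ (mul_le_mul_right hc _)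
  rw [← lintegral_const_mul' _ _ ENNReal.ofReal_ne_top]
  refine lintegral_mono_ae ?_
  filter_upwards [ae_restrict_mem measurableSet_ball] with z hz
  have hz1 : ‖z‖ < 1 := by simpa using hz
  have hw := mul_one_sub_norm_le (z := z) hp ⟨ht.1.le, ht.2.le⟩
  have hw0 : 0 ≤ t * (1 - ‖z‖) := mul_nonneg ht0.le (by linarith)
  rw [(hasDerivAt_seg p t z).deriv, ← ofReal_norm, Complex.norm_real, Real.norm_of_nonneg ht0.le,
    ← ENNReal.ofReal_pow ht0.le, ← mul_assoc, ← mul_assoc, ← ENNReal.ofReal_mul (by positivity),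
    ← ENNReal.ofReal_mul (by positivity)]
  gcongr
  calc (1 - ‖z‖) ^ α = t ^ (-α) * (t * (1 - ‖z‖)) ^ α := by
        rw [Real.mul_rpow ht0.le (by linarith), ← mul_assoc, ← Real.rpow_add ht0]
        simp
    _ ≤ t ^ (-α) * (1 - ‖p + t * (z - p)‖) ^ α := by gcongr
    _ = _ := by
        rw [← Real.rpow_two, ← Real.rpow_add ht0]
        ring_nf

/-- The squared growth rate cancels the weight exactly, leaving a constant on the disc. -/
lemma lintegral_sq_le_of_growth {α : ℝ} {f : ℂ → ℂ} (hf : f ∈ Space α) {x : ℂ → ℂ} {c : ℝ}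
    (h : ∀ z ∈ ball (0 : ℂ) 1, ‖x z‖ ≤ c * norm α f * (1 - ‖z‖) ^ (-(α / 2))) :
    ∫⁻ z, ‖x z‖ₑ ^ 2 ∂diskMeasure α ≤
      ENNReal.ofReal (c ^ 2) * sqNorm α f * volume (ball (0 : ℂ) 1) := by
  rw [← setLIntegral_const, lintegral_diskMeasure]
  refine lintegral_mono_ae ?_
  filter_upwards [ae_restrict_mem measurableSet_ball] with z hz
  have hz1 : 0 < 1 - ‖z‖ := by simpa using hz
  have h1 := enorm_sq_le_of_norm_le hf (x := x z) (c := c * (1 - ‖z‖) ^ (-(α / 2)))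
    ((h z hz).trans (le_of_eq (by ring)))
  calc _ ≤ ENNReal.ofReal ((1 - ‖z‖) ^ α) *
          (ENNReal.ofReal ((c * (1 - ‖z‖) ^ (-(α / 2))) ^ 2) * sqNorm α f) := by gcongr
    _ = _ := by
      rw [← mul_assoc, ← ENNReal.ofReal_mul (by positivity), mul_pow, ← Real.rpow_mul_natCast hz1.le,
        mul_left_comm, ← Real.rpow_add hz1,
        show α + -(α / 2) * ((2 : ℕ) : ℝ) = 0 by push_cast; ring, Real.rpow_zero, mul_one]

lemma norm_seg_le {α : ℝ} (hα : 0 < α) {f : ℂ → ℂ} (hf : f ∈ Space α) {p : ℂ} (hp : ‖p‖ ≤ 1)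
    {t : ℝ} (ht : t ∈ Set.Ioo (0 : ℝ) 1) {z : ℂ} (hz : z ∈ ball (0 : ℂ) 1) :
    ‖f (p + t * (z - p))‖ ≤
      growthConst α * norm α f * (t ^ (-(α / 2)) * (1 - ‖z‖) ^ (-(α / 2))) := by
  have hz1 : 0 < 1 - ‖z‖ := by simpa using hz
  have hg := growthConst_pos hα
  have hN := norm_nonneg' α f
  have ht0 := ht.1
  refine (norm_le hα hf (seg_mem_ball hp hz (Set.Ioo_subset_Ioc_self ht))).trans ?_
  rw [← Real.mul_rpow ht.1.le hz1.le]
  gcongr ?_ * ?_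
  exact Real.rpow_le_rpow_of_nonpos (by positivity)
    (mul_one_sub_norm_le hp ⟨ht.1.le, ht.2.le⟩) (by linarith)

lemma aemeasurable_seg (α : ℝ) {p : ℂ} (hp : ‖p‖ ≤ 1) {g : ℂ → ℂ}
    (hg : ContinuousOn g (ball 0 1)) :
    AEMeasurable (Function.uncurry fun (t : ℝ) (z : ℂ) => g (p + t * (z - p)))
      ((volume.restrict (Set.Ioo 0 1)).prod (diskMeasure α)) :=
  aemeasurable_prod_diskMeasure (F := fun x => g (p + x.1 * (x.2 - p))) α measurableSet_Ioo
    (hg.comp (by fun_prop) fun _ hx => seg_mem_ball hp hx.2 (Set.Ioo_subset_Ioc_self hx.1))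

/-- Composition alone gives slices of norm `t ^ (-1 - α / 2)`, not integrable at `0`. It is
therefore used only for `t ≥ 1 / 2`; for smaller `t` the segment point is near `p`, where a growth
bound on `g` gives the integrable rate `t ^ (-α / 2)`. -/
lemma lintegral_segMean_sq_le {α : ℝ} (hα₀ : 0 < α) (hα₂ : α < 2) {p : ℂ} (hp : ‖p‖ ≤ 1)
    {f g : ℂ → ℂ} (hf : f ∈ Space α) (hg : ContinuousOn g (ball 0 1)) {c : ℝ}
    (h : ∀ t ∈ Set.Ioo (0 : ℝ) (1 / 2), ∀ z ∈ ball (0 : ℂ) 1, ‖g (p + t * (z - p))‖ ≤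
      c * norm α f * (t ^ (-(α / 2)) * (1 - ‖z‖) ^ (-(α / 2)))) :
    ∫⁻ z, ‖segMean p g z‖ₑ ^ 2 ∂diskMeasure α ≤
      ENNReal.ofReal (1 / (1 - α / 2)) ^ 2 *
        (ENNReal.ofReal (2 ^ (2 + α)) * ∫⁻ z, ‖g z‖ₑ ^ 2 ∂diskMeasure α +
          ENNReal.ofReal (c ^ 2) * sqNorm α f * volume (ball (0 : ℂ) 1)) := by
  refine le_trans (lintegral_mono fun z => pow_le_pow_left' (enorm_integral_le_lintegral_enorm _) 2)
    (lintegral_sq_lintegral_Ioo_le (by linarith) (aemeasurable_seg α hp hg).enorm fun t ht => ?_)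
  have ht0 := ht.1
  rcases lt_or_ge t (1 / 2) with ht2 | ht2
  · have h1 := lintegral_sq_le_of_growth hf (x := fun z => g (p + t * (z - p)))
      (c := c * t ^ (-(α / 2))) fun z hz => (h t ⟨ht0, ht2⟩ z hz).trans (le_of_eq (by ring))
    refine h1.trans ?_
    rw [mul_pow, ← Real.rpow_mul_natCast ht0.le, ENNReal.ofReal_mul (by positivity)]
    calc _ = ENNReal.ofReal (c ^ 2) * sqNorm α f * volume (ball (0 : ℂ) 1) *
          ENNReal.ofReal (t ^ (-(2 * (α / 2)))) := by
            rw [show -(α / 2) * ((2 : ℕ) : ℝ) = -(2 * (α / 2)) by push_cast; ring]; ring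
      _ ≤ _ := by gcongr; exact le_add_self
  · refine (lintegral_comp_seg_le hα₀.le hp ht fun z => ‖g z‖ₑ ^ 2).trans ?_
    have h1 : t ^ (-(2 + α)) ≤ 2 ^ (2 + α) := by
      refine (Real.rpow_le_rpow_of_nonpos (by norm_num) ht2 (by linarith)).trans (le_of_eq ?_)
      rw [Real.rpow_neg (by norm_num), ← Real.inv_rpow (by norm_num)]
      norm_num
    have h2 : (1 : ℝ≥0∞) ≤ ENNReal.ofReal (t ^ (-(2 * (α / 2)))) := by
      rw [ENNReal.one_le_ofReal]
      exact Real.one_le_rpow_of_pos_of_le_one_of_nonpos ht0 ht.2.le (by linarith)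
    calc _ ≤ ENNReal.ofReal (2 ^ (2 + α)) * (∫⁻ z, ‖g z‖ₑ ^ 2 ∂diskMeasure α) * 1 := by
          rw [mul_one]; gcongr
      _ ≤ _ := by gcongr; exact le_self_add

lemma norm_setIntegral_le_rpow {a K : ℝ} (ha : a < 1) {G : ℝ → ℂ}
    (h : ∀ t ∈ Set.Ioo (0 : ℝ) 1, ‖G t‖ ≤ K * t ^ (-a)) :
    ‖∫ t in Set.Ioo (0 : ℝ) 1, G t‖ ≤ K / (1 - a) := by
  refine (norm_integral_le_of_norm_le (integrableOn_Ioo_rpow ha K)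
    ((ae_restrict_mem measurableSet_Ioo).mono h)).trans (le_of_eq ?_)
  rw [integral_const_mul, ← integral_Ioc_eq_integral_Ioo,
    ← intervalIntegral.integral_of_le zero_le_one, integral_rpow (Or.inl (by linarith)),
    Real.one_rpow, Real.zero_rpow (by linarith), sub_zero, mul_one_div, neg_add_eq_sub]

lemma enorm_segMean_zero_sq_le {α : ℝ} (hα₂ : α < 2) {p : ℂ} {f g : ℂ → ℂ} (hf : f ∈ Space α)
    {c : ℝ} (h : ∀ t ∈ Set.Ioo (0 : ℝ) 1, ‖g (p + t * (0 - p))‖ ≤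
      c * norm α f * t ^ (-(α / 2))) :
    ‖segMean p g 0‖ₑ ^ 2 ≤ ENNReal.ofReal ((c / (1 - α / 2)) ^ 2) * sqNorm α f :=
  enorm_sq_le_of_norm_le hf ((norm_setIntegral_le_rpow (by linarith) h).trans
    (le_of_eq (by ring)))

/-- The factor `t`, produced by differentiating a segment mean, improves the slice norm from `t ^
(-1 - α / 2)` to `t ^ (-α / 2)`, which is integrable for `α < 2`. -/
lemma lintegral_sq_lintegral_mul_seg_le {α : ℝ} (hα₀ : 0 < α) (hα₂ : α < 2) {p : ℂ} (hp : ‖p‖ ≤ 1)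
    {g : ℂ → ℂ} (hg : ContinuousOn g (ball 0 1)) :
    ∫⁻ z, (∫⁻ t in Set.Ioo (0 : ℝ) 1, ‖(t : ℂ) * g (p + t * (z - p))‖ₑ) ^ 2 ∂diskMeasure α ≤
      ENNReal.ofReal (1 / (1 - α / 2)) ^ 2 * ∫⁻ z, ‖g z‖ₑ ^ 2 ∂diskMeasure α := by
  refine lintegral_sq_lintegral_Ioo_le (a := α / 2) (by linarith) ?_ fun t ht => ?_
  · have h1 : AEMeasurable (fun x : ℝ × ℂ => (x.1 : ℂ))
      ((volume.restrict (Set.Ioo 0 1)).prod (diskMeasure α)) := by fun_prop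
    exact (h1.mul (aemeasurable_seg α hp hg)).enorm
  · have ht0 := ht.1
    simp only [enorm_mul, mul_pow]
    rw [lintegral_const_mul' _ _ (by simp), ← ofReal_norm, Complex.norm_real,
      Real.norm_of_nonneg ht0.le, ← ENNReal.ofReal_pow ht0.le]
    refine (mul_le_mul_right (lintegral_comp_seg_le hα₀.le hp ht fun z => ‖g z‖ₑ ^ 2) _).trans
      (le_of_eq ?_)
    rw [← mul_assoc, ← ENNReal.ofReal_mul (by positivity), ← Real.rpow_two, ← Real.rpow_add ht0,
      mul_comm]
    ring_nf

/-! ### The operator `A`. -/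

lemma segBound_one {α : ℝ} (hα₀ : 0 < α) (hα₂ : α < 2) {f : ℂ → ℂ} (hf : f ∈ Space α) :
    SegBound 1 f := by
  intro r hr
  refine ⟨growthConst α * norm α f * (1 - r) ^ (-(α / 2)), α / 2, by linarith,
    fun t ht z hz => ?_⟩
  have hg := growthConst_pos hα₀
  have hN := norm_nonneg' α f
  have ht0 := ht.1
  refine (norm_seg_le hα₀ hf (by simp) ht (by rw [mem_ball_zero_iff]; linarith)).trans ?_
  have h1 : (1 - ‖z‖) ^ (-(α / 2)) ≤ (1 - r) ^ (-(α / 2)) :=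
    Real.rpow_le_rpow_of_nonpos (by linarith) (by linarith) (by linarith)
  calc _ ≤ growthConst α * norm α f * (t ^ (-(α / 2)) * (1 - r) ^ (-(α / 2))) := by gcongr
    _ = _ := by ring

/-- The segment mean from `1` is bounded on `D_α`. -/
lemma exists_sqNorm_segMean_one_le {α : ℝ} (hα₀ : 0 < α) (hα₂ : α < 2) :
    ∃ C : ℝ≥0∞, C ≠ ∞ ∧ ∀ f ∈ Space α, sqNorm α (segMean 1 f) ≤ C * sqNorm α f := by
  refine ⟨ENNReal.ofReal ((growthConst α / (1 - α / 2)) ^ 2) +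
    ENNReal.ofReal (1 / (1 - α / 2)) ^ 2, by finiteness, fun f hf => ?_⟩
  rw [sqNorm, add_mul]
  refine add_le_add (enorm_segMean_zero_sq_le hα₂ hf fun t ht => ?_) ?_
  · simpa using norm_seg_le hα₀ hf (p := 1) (by simp) ht (mem_ball_self one_pos)
  · refine le_trans (le_trans (lintegral_diskMeasure_mono fun z hz => ?_)
      (lintegral_sq_lintegral_mul_seg_le hα₀ hα₂ (p := 1) (by simp)
        (differentiableOn_deriv hf.1).continuousOn)) (mul_le_mul_right lintegral_deriv_le _)
    rw [(segMean_hasDerivAt (by simp) hf.1 (segBound_one hα₀ hα₂ hf) hz).2.2.deriv]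
    exact pow_le_pow_left' (enorm_integral_le_lintegral_enorm _) 2

lemma aemeasurable_diskMeasure (α : ℝ) {g : ℂ → ℂ} (hg : ContinuousOn g (ball 0 1)) :
    AEMeasurable g (diskMeasure α) :=
  (hg.aemeasurable measurableSet_ball).mono_ac (diskMeasure_absolutelyContinuous α)

lemma diskMeasure_univ_lt_top {α : ℝ} (hα : 0 ≤ α) : diskMeasure α Set.univ < ∞ := by
  rw [← lintegral_one, lintegral_diskMeasure]
  refine lt_of_le_of_lt ?_ (measure_ball_lt_top (μ := volume) (x := (0 : ℂ)) (r := 1))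
  rw [← setLIntegral_one]
  refine lintegral_mono_ae ?_
  filter_upwards [ae_restrict_mem measurableSet_ball] with z hz
  have hz1 : 0 < 1 - ‖z‖ := by simpa using hz
  rw [mul_one, ENNReal.ofReal_le_one]
  exact Real.rpow_le_one hz1.le (by linarith [norm_nonneg z]) hα

/-! ### The reflection `z ↦ -z`. -/

section reflection

lemma lintegral_diskMeasure_neg (α : ℝ) (h : ℂ → ℝ≥0∞) :
    ∫⁻ z, h (-z) ∂diskMeasure α = ∫⁻ z, h z ∂diskMeasure α := by
  have := lintegral_ball_rotate 0 1 Real.pi fun z => ENNReal.ofReal ((1 - ‖z‖) ^ α) * h z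
  rw [lintegral_diskMeasure, lintegral_diskMeasure, ← this]
  simp [circleMap]

lemma sqNorm_comp_neg (α : ℝ) (f : ℂ → ℂ) : sqNorm α (fun z => f (-z)) = sqNorm α f := by
  unfold sqNorm
  rw [← lintegral_diskMeasure_neg α fun z => ‖deriv f z‖ₑ ^ 2]
  simp [deriv_comp_neg]

lemma differentiableOn_comp_neg {f : ℂ → ℂ} (hf : DifferentiableOn ℂ f (ball 0 1)) :
    DifferentiableOn ℂ (fun z => f (-z)) (ball 0 1) :=
  hf.comp (by fun_prop) fun z hz => by simpa using hz

lemma comp_neg_mem_space {α : ℝ} {f : ℂ → ℂ} (hf : f ∈ Space α) :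
    (fun z => f (-z)) ∈ Space α := by
  rw [mem_space_iff] at hf ⊢
  exact ⟨differentiableOn_comp_neg hf.1, by rw [sqNorm_comp_neg]; exact hf.2⟩

/-- Hardy's inequality at the boundary point `-1`. -/
lemma exists_lintegral_div_neg_one_sub_le {α : ℝ} (hα₀ : 0 < α) (hα₂ : α < 2) :
    ∃ C : ℝ≥0∞, C ≠ ∞ ∧ ∀ f ∈ Space α,
      ∫⁻ z, ‖f z / (-1 - z)‖ₑ ^ 2 ∂diskMeasure α ≤ C * sqNorm α f := by
  obtain ⟨C, hC, h⟩ := exists_lintegral_div_one_sub_le hα₀ hα₂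
  refine ⟨C, hC, fun f hf => ?_⟩
  refine le_trans (le_of_eq ?_) ((h _ (comp_neg_mem_space hf)).trans (by rw [sqNorm_comp_neg]))
  rw [← lintegral_diskMeasure_neg]
  refine lintegral_congr fun z => ?_
  rw [show -1 - -z = -(1 - z) by ring, div_neg, enorm_neg]

end reflection

/-! ### The Cesàro operator. -/

section cesaro

lemma norm_div_one_sub_le {α : ℝ} (hα : 0 < α) {f : ℂ → ℂ} (hf : f ∈ Space α) {z : ℂ} {r : ℝ}
    (hz : ‖z‖ ≤ r) (hr : r < 1) :
    ‖f z / (1 - z)‖ ≤ growthConst α * norm α f * (1 - r) ^ (-(α / 2)) / (1 - r) := by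
  have hg := growthConst_pos hα
  have hN := norm_nonneg' α f
  have h1 : (1 - ‖z‖) ^ (-(α / 2)) ≤ (1 - r) ^ (-(α / 2)) :=
    Real.rpow_le_rpow_of_nonpos (by linarith) (by linarith) (by linarith)
  rw [norm_div]
  gcongr
  · exact (norm_le hα hf (by rw [mem_ball_zero_iff]; linarith)).trans (by gcongr)
  · linarith [one_sub_norm_le z]

lemma norm_zero_seg_le {t : ℝ} (ht : t ∈ Set.Ioo (0 : ℝ) 1) {z : ℂ} :
    ‖(0 : ℂ) + t * (z - 0)‖ ≤ ‖z‖ := by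
  rw [zero_add, sub_zero, norm_mul, Complex.norm_real, Real.norm_of_nonneg ht.1.le]
  exact mul_le_of_le_one_left (norm_nonneg _) ht.2.le

lemma segBound_cesaro {α : ℝ} (hα : 0 < α) {f : ℂ → ℂ} (hf : f ∈ Space α) :
    SegBound 0 fun ζ => f ζ / (1 - ζ) := fun r hr =>
  ⟨growthConst α * norm α f * (1 - r) ^ (-(α / 2)) / (1 - r), 0, zero_lt_one,
    fun t ht z hz => by
      simpa using norm_div_one_sub_le hα hf ((norm_zero_seg_le ht).trans hz) hr⟩

lemma differentiableOn_div_one_sub {f : ℂ → ℂ} (hf : DifferentiableOn ℂ f (ball 0 1)) :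
    DifferentiableOn ℂ (fun ζ => f ζ / (1 - ζ)) (ball 0 1) :=
  hf.div (by fun_prop) fun _ hz => one_sub_ne_zero hz

lemma norm_segMean_cesaro_le {α : ℝ} (hα : 0 < α) {f : ℂ → ℂ} (hf : f ∈ Space α) {z : ℂ} {r : ℝ}
    (hz : ‖z‖ ≤ r) (hr : r < 1) :
    ‖segMean 0 (fun ζ => f ζ / (1 - ζ)) z‖ ≤
      growthConst α * norm α f * (1 - r) ^ (-(α / 2)) / (1 - r) := by
  have h := norm_setIntegral_le_rpow (a := 0) zero_lt_one
    (G := fun t => f (0 + t * (z - 0)) / (1 - (0 + t * (z - 0))))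
    (K := growthConst α * norm α f * (1 - r) ^ (-(α / 2)) / (1 - r)) fun t ht => by
      simpa using norm_div_one_sub_le hα hf ((norm_zero_seg_le ht).trans hz) hr
  simpa [segMean] using h

/-- For `|z| ≥ 1/2` the equation `z (M g)' = g - M g` bounds the derivative by `g` and `M g`, both
in `L²` by Hardy's inequality. For `|z| < 1/2` dividing by `z` is not allowed, and Cauchy's estimate
is used instead. -/
lemma exists_sqNorm_segMean_cesaro_le {α : ℝ} (hα₀ : 0 < α) (hα₂ : α < 2) :
    ∃ C : ℝ≥0∞, C ≠ ∞ ∧ ∀ f ∈ Space α,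
      sqNorm α (segMean 0 fun ζ => f ζ / (1 - ζ)) ≤ C * sqNorm α f := by
  obtain ⟨C, hC, hardy⟩ := exists_lintegral_div_one_sub_le hα₀ hα₂
  have hμ := diskMeasure_univ_lt_top hα₀.le
  set m := diskMeasure α Set.univ
  have hV : volume (ball (0 : ℂ) 1) < ∞ := measure_ball_lt_top
  set V := volume (ball (0 : ℂ) 1)
  set A := ENNReal.ofReal (1 / (1 - α / 2)) ^ 2
  set B := ENNReal.ofReal (2 ^ (2 + α))
  set c := growthConst α
  have hc0 : 0 < c := growthConst_pos hα₀
  -- Bound for the mean on `|w| ≤ 3/4`, which contains the Cauchy circles of radius `1/4` about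
  -- points with `|z| < 1/2`.
  set K := c * (1 - 3 / 4) ^ (-(α / 2)) / (1 - 3 / 4)
  refine ⟨1 + (8 * C + 8 * (A * (B * C + ENNReal.ofReal ((2 * c) ^ 2) * V)) +
    ENNReal.ofReal ((K / (1 / 4)) ^ 2) * m), by finiteness, fun f hf => ?_⟩
  have hN := norm_nonneg' α f
  have hgd := differentiableOn_div_one_sub hf.1
  have hsb := segBound_cesaro hα₀ hf
  have hard := hardy f hf
  set g : ℂ → ℂ := fun ζ => f ζ / (1 - ζ) with hg
  set S := sqNorm α f with hS
  have hM := differentiableOn_segMean (by simp) hgd hsb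
  have hL2 : ∫⁻ z, ‖segMean 0 g z‖ₑ ^ 2 ∂diskMeasure α ≤
      A * (B * (C * S) + ENNReal.ofReal ((2 * c) ^ 2) * S * V) := by
    refine (lintegral_segMean_sq_le hα₀ hα₂ (p := 0) (by simp) hf hgd.continuousOn (c := 2 * c)
      fun t ht z hz => ?_).trans (by gcongr)
    have hz1 : ‖z‖ < 1 := by simpa using hz
    have ht' : t ∈ Set.Ioo (0 : ℝ) 1 := ⟨ht.1, by linarith [ht.2]⟩
    have h1 := norm_seg_le hα₀ hf (p := 0) (by simp) ht' hz
    have h2 : 1 / 2 ≤ ‖1 - ((0 : ℂ) + t * (z - 0))‖ := by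
      refine le_trans ?_ (one_sub_norm_le _)
      rw [zero_add, sub_zero, norm_mul, Complex.norm_real, Real.norm_of_nonneg ht.1.le]
      nlinarith [ht.1, ht.2, norm_nonneg z]
    rw [hg]
    simp only
    rw [norm_div, div_le_iff₀ (by linarith)]
    refine h1.trans ?_
    have h3 : 0 ≤ c * norm α f * (t ^ (-(α / 2)) * (1 - ‖z‖) ^ (-(α / 2))) :=
      (norm_nonneg _).trans h1
    nlinarith
  have hpt : ∀ z ∈ ball (0 : ℂ) 1, ‖deriv (segMean 0 g) z‖ₑ ^ 2 ≤
      8 * ‖g z‖ₑ ^ 2 + 8 * ‖segMean 0 g z‖ₑ ^ 2 + ENNReal.ofReal ((K / (1 / 4)) ^ 2) * S := by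
    intro z hz
    rcases le_or_gt (1 / 2) ‖z‖ with h | h
    · refine le_add_right ?_
      have h1 := sub_mul_deriv_segMean (p := 0) (by simp) hgd hsb hz
      have h2 : ‖deriv (segMean 0 g) z‖ ≤ ‖(2 : ℂ)‖ * ‖g z - segMean 0 g z‖ := by
        rw [← h1, norm_mul, sub_zero, Complex.norm_ofNat]
        nlinarith [norm_nonneg (deriv (segMean 0 g) z)]
      rw [← norm_mul] at h2
      have h3 := (enorm_le_iff_norm_le.2 h2)
      calc _ ≤ ‖2 * (g z - segMean 0 g z)‖ₑ ^ 2 := by gcongr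
        _ ≤ (2 * (‖g z‖ₑ + ‖segMean 0 g z‖ₑ)) ^ 2 := by
            rw [enorm_mul]
            gcongr
            · simp [← ofReal_norm]
            · exact enorm_sub_le
        _ ≤ 2 ^ 2 * (2 * ‖g z‖ₑ ^ 2 + 2 * ‖segMean 0 g z‖ₑ ^ 2) := by
            rw [mul_pow]; gcongr; exact add_sq_le_two_mul _ _
        _ = _ := by ring
    · refine le_add_left ?_
      refine enorm_sq_le_of_norm_le hf ?_
      have hsub : ∀ w ∈ closedBall z (1 / 4), ‖w‖ ≤ 3 / 4 := fun w hw => by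
        rw [mem_closedBall, dist_eq_norm] at hw
        have := norm_le_norm_add_norm_sub' w z
        linarith
      refine (Complex.norm_deriv_le_of_forall_mem_sphere_norm_le (by norm_num : (0 : ℝ) < 1 / 4)
        (hM.diffContOnCl_ball fun w hw => ?_) fun w hw => norm_segMean_cesaro_le hα₀ hf
        (hsub w (sphere_subset_closedBall hw)) (by norm_num)).trans (le_of_eq ?_)
      · rw [mem_ball_zero_iff]; linarith [hsub w hw]
      · simp only [K, c]; ring
  have hgm := aemeasurable_diskMeasure α hgd.continuousOn
  have hMm := aemeasurable_diskMeasure α hM.continuousOn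
  rw [sqNorm, add_mul, one_mul]
  refine add_le_add ?_ ?_
  · have : segMean 0 g 0 = f 0 := by simp [segMean, hg]
    rw [this]; exact le_self_add
  · calc _ ≤ _ := lintegral_diskMeasure_mono hpt
      _ = 8 * (∫⁻ z, ‖g z‖ₑ ^ 2 ∂diskMeasure α) +
          8 * (∫⁻ z, ‖segMean 0 g z‖ₑ ^ 2 ∂diskMeasure α) +
          ENNReal.ofReal ((K / (1 / 4)) ^ 2) * S * m := by
        rw [lintegral_add_right _ (by fun_prop), lintegral_const, lintegral_add_left' (by fun_prop),
          lintegral_const_mul' _ _ (by simp), lintegral_const_mul' _ _ (by simp)]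
      _ ≤ 8 * (C * S) + 8 * (A * (B * (C * S) + ENNReal.ofReal ((2 * c) ^ 2) * S * V)) +
          ENNReal.ofReal ((K / (1 / 4)) ^ 2) * S * m := by gcongr
      _ = _ := by ring

end cesaro

/-! ### The operator `J`. -/

section opJ

lemma neg_one_sub_ne_zero {z : ℂ} (hz : z ∈ ball (0 : ℂ) 1) : -1 - z ≠ 0 := by
  have h := one_sub_ne_zero (z := -z) (by simpa using hz)
  intro h'
  apply h
  linear_combination -h'

lemma le_norm_neg_one_sub_seg {t : ℝ} (ht : t ∈ Set.Icc (0 : ℝ) 1) (z : ℂ) :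
    2 - t - t * ‖z‖ ≤ ‖-1 - (1 + t * (z - 1))‖ := by
  have e : -1 - (1 + t * (z - 1)) = -((2 - t : ℝ) + t * z : ℂ) := by push_cast; ring
  have h := norm_sub_le_norm_add ((2 - t : ℝ) : ℂ) (t * z)
  rw [Complex.norm_real, norm_mul, Complex.norm_real, Real.norm_of_nonneg ht.1,
    Real.norm_of_nonneg (by linarith [ht.2])] at h
  rwa [e, norm_neg]

lemma segBound_opJ {α : ℝ} (hα₀ : 0 < α) (hα₂ : α < 2) {f : ℂ → ℂ} (hf : f ∈ Space α) :
    SegBound 1 fun ζ => f ζ / (-1 - ζ) := by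
  intro r hr
  obtain ⟨K, a, ha, h⟩ := segBound_one hα₀ hα₂ hf r hr
  refine ⟨K / (1 - r), a, ha, fun t ht z hz => ?_⟩
  have h1 := h t ht z hz
  have h2 := le_norm_neg_one_sub_seg ⟨ht.1.le, ht.2.le⟩ z
  have h3 : 1 - r ≤ ‖-1 - (1 + t * (z - 1))‖ := by
    nlinarith [mul_nonneg (sub_nonneg.2 ht.2.le) (norm_nonneg z), ht.2]
  rw [norm_div, div_mul_eq_mul_div]
  have := (norm_nonneg _).trans h1
  gcongr

lemma differentiableOn_div_neg_one_sub {f : ℂ → ℂ} (hf : DifferentiableOn ℂ f (ball 0 1)) :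
    DifferentiableOn ℂ (fun ζ => f ζ / (-1 - ζ)) (ball 0 1) :=
  hf.div (by fun_prop) fun _ hz => neg_one_sub_ne_zero hz

lemma aemeasurable_lintegral_mul_seg (α : ℝ) {p : ℂ} (hp : ‖p‖ ≤ 1) {g : ℂ → ℂ}
    (hg : ContinuousOn g (ball 0 1)) :
    AEMeasurable (fun z => ∫⁻ t in Set.Ioo (0 : ℝ) 1, ‖(t : ℂ) * g (p + t * (z - p))‖ₑ)
      (diskMeasure α) := by
  have h1 : AEMeasurable (fun x : ℝ × ℂ => (x.1 : ℂ))
      ((volume.restrict (Set.Ioo 0 1)).prod (diskMeasure α)) := by fun_prop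
  exact ((h1.mul (aemeasurable_seg α hp hg)).enorm).lintegral_prod_left'

/-- The two singular points are `1`, the base of the segments, and `-1`, the pole of `g`. If `|z -
1| ≥ 1`, the equation `(z - 1) (M g)' = g - M g` and Hardy's inequality at `-1` apply. If `|z - 1| <
1`, the whole segment is at distance at least `1` from `-1`, and `g'` is dominated by `|f'| + |f|`,
giving the terms `X` and `Y`. -/
lemma exists_sqNorm_segMean_opJ_le {α : ℝ} (hα₀ : 0 < α) (hα₂ : α < 2) :
    ∃ C : ℝ≥0∞, C ≠ ∞ ∧ ∀ f ∈ Space α,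
      sqNorm α (segMean 1 fun ζ => f ζ / (-1 - ζ)) ≤ C * sqNorm α f := by
  obtain ⟨C, hC, hardy⟩ := exists_lintegral_div_neg_one_sub_le hα₀ hα₂
  have hV : volume (ball (0 : ℂ) 1) < ∞ := measure_ball_lt_top
  set V := volume (ball (0 : ℂ) 1)
  set A := ENNReal.ofReal (1 / (1 - α / 2)) ^ 2
  set B := ENNReal.ofReal (2 ^ (2 + α))
  set c := growthConst α
  have hc0 : 0 < c := growthConst_pos hα₀
  set D := ENNReal.ofReal (c ^ 2)
  refine ⟨ENNReal.ofReal ((c / (1 - α / 2)) ^ 2) + ((2 * C + 2 * (A * (B * C + D * V))) +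
    (2 * A + 2 * (A * (D * V)))), by finiteness, fun f hf => ?_⟩
  have hN := norm_nonneg' α f
  have hgd := differentiableOn_div_neg_one_sub hf.1
  have hsb := segBound_opJ hα₀ hα₂ hf
  have hard := hardy f hf
  set g : ℂ → ℂ := fun ζ => f ζ / (-1 - ζ) with hg
  set S := sqNorm α f with hS
  have hM := differentiableOn_segMean (by simp) hgd hsb
  have hsmall : ∀ t ∈ Set.Ioo (0 : ℝ) 1, ∀ z ∈ ball (0 : ℂ) 1,
      1 ≤ ‖-1 - (1 + t * (z - 1))‖ → ‖g (1 + t * (z - 1))‖ ≤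
        c * norm α f * (t ^ (-(α / 2)) * (1 - ‖z‖) ^ (-(α / 2))) := by
    intro t ht z hz h
    refine le_trans ?_ (norm_seg_le hα₀ hf (p := 1) (by simp) ht hz)
    rw [hg]
    simp only
    rw [norm_div]
    exact div_le_self (norm_nonneg _) h
  have hL2 : ∫⁻ z, ‖segMean 1 g z‖ₑ ^ 2 ∂diskMeasure α ≤
      A * (B * (C * S) + D * S * V) := by
    refine (lintegral_segMean_sq_le hα₀ hα₂ (p := 1) (by simp) hf hgd.continuousOn (c := c)
      fun t ht z hz => hsmall t ⟨ht.1, by linarith [ht.2]⟩ z hz ?_).trans (by gcongr)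
    have hz1 : ‖z‖ < 1 := by simpa using hz
    have h2 := le_norm_neg_one_sub_seg ⟨ht.1.le, by linarith [ht.2]⟩ z
    nlinarith [ht.1, ht.2, norm_nonneg z]
  have hdf := (differentiableOn_deriv hf.1).continuousOn
  set X : ℂ → ℝ≥0∞ := fun z =>
    ∫⁻ t in Set.Ioo (0 : ℝ) 1, ‖(t : ℂ) * deriv f (1 + t * (z - 1))‖ₑ
  set Y : ℂ → ℝ≥0∞ := fun z =>
    ∫⁻ t in Set.Ioo (0 : ℝ) 1, ‖(t : ℂ) * f (1 + t * (z - 1))‖ₑ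
  have hXm : AEMeasurable X (diskMeasure α) := aemeasurable_lintegral_mul_seg α (by simp) hdf
  have hX : ∫⁻ z, X z ^ 2 ∂diskMeasure α ≤ A * S :=
    (lintegral_sq_lintegral_mul_seg_le hα₀ hα₂ (p := 1) (by simp) hdf).trans
      (by gcongr; exact lintegral_deriv_le)
  have hY : ∫⁻ z, Y z ^ 2 ∂diskMeasure α ≤ A * (D * S * V) :=
    (lintegral_sq_lintegral_mul_seg_le hα₀ hα₂ (p := 1) (by simp) hf.1.continuousOn).trans
      (by gcongr; exact lintegral_sq_le_of_growth hf fun z hz => norm_le hα₀ hf hz)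
  have hpt : ∀ z ∈ ball (0 : ℂ) 1, ‖deriv (segMean 1 g) z‖ₑ ^ 2 ≤
      (2 * ‖g z‖ₑ ^ 2 + 2 * ‖segMean 1 g z‖ₑ ^ 2) + (2 * X z ^ 2 + 2 * Y z ^ 2) := by
    intro z hz
    rcases le_or_gt 1 ‖z - 1‖ with h | h
    · refine le_add_right ?_
      have h1 := sub_mul_deriv_segMean (p := 1) (by simp) hgd hsb hz
      have h2 : ‖deriv (segMean 1 g) z‖ ≤ ‖g z - segMean 1 g z‖ := by
        rw [← h1, norm_mul]
        exact le_mul_of_one_le_left (norm_nonneg _) h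
      refine le_trans (pow_le_pow_left' ((enorm_le_iff_norm_le.2 h2).trans enorm_sub_le) 2) ?_
      exact add_sq_le_two_mul _ _
    · refine le_add_left (le_trans (pow_le_pow_left' ?_ 2) (add_sq_le_two_mul _ _))
      rw [(segMean_hasDerivAt (by simp) hgd hsb hz).2.2.deriv]
      refine (enorm_integral_le_lintegral_enorm _).trans ?_
      have hYm : AEMeasurable (fun t : ℝ => ‖(t : ℂ) * deriv f (1 + t * (z - 1))‖ₑ)
          (volume.restrict (Set.Ioo 0 1)) := by
        have := (continuousOn_seg (p := 1) (by simp) hz hdf).mono Set.Ioo_subset_Ioc_self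
        exact (ContinuousOn.aemeasurable (ContinuousOn.mul (by fun_prop) this)
          measurableSet_Ioo).enorm
      rw [← lintegral_add_left' hYm]
      refine lintegral_mono_ae ?_
      filter_upwards [ae_restrict_mem measurableSet_Ioo] with t ht
      have hw := seg_mem_ball (p := 1) (by simp) hz (Set.Ioo_subset_Ioc_self ht)
      set w : ℂ := 1 + t * (z - 1) with hwdef
      -- Here `-1 - w = -(2 + t (z - 1))` and `|t (z - 1)| < 1`.
      have hw1 : 1 ≤ ‖-1 - w‖ := by
        have h2 : ‖(2 : ℂ)‖ ≤ ‖-1 - w‖ + ‖(t : ℂ) * (z - 1)‖ := by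
          refine le_trans (le_of_eq ?_) (norm_add_le _ _)
          rw [hwdef, ← norm_neg]
          congr 1; ring
        rw [norm_mul, Complex.norm_real, Real.norm_of_nonneg ht.1.le, Complex.norm_ofNat] at h2
        nlinarith [ht.1, ht.2, norm_nonneg (z - 1)]
      have hne := neg_one_sub_ne_zero hw
      have hdg : deriv g w = deriv f w / (-1 - w) + f w / (-1 - w) ^ 2 := by
        have := ((hf.1.differentiableAt (isOpen_ball.mem_nhds hw)).hasDerivAt.div
          ((hasDerivAt_id w).const_sub (-1)) hne).deriv
        rw [hg]
        refine Eq.trans this ?_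
        simp only [id]
        field_simp
        ring
      rw [hdg, mul_add]
      refine (enorm_add_le _ _).trans (add_le_add ?_ ?_)
      · refine enorm_le_iff_norm_le.2 ?_
        rw [norm_mul, norm_mul, norm_div]
        gcongr
        exact div_le_self (norm_nonneg _) hw1
      · refine enorm_le_iff_norm_le.2 ?_
        rw [norm_mul, norm_mul, norm_div, norm_pow]
        gcongr
        exact div_le_self (norm_nonneg _) (one_le_pow₀ hw1)
  have hgm := aemeasurable_diskMeasure α hgd.continuousOn
  have hMm := aemeasurable_diskMeasure α hM.continuousOn
  rw [sqNorm, add_mul]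
  refine add_le_add (enorm_segMean_zero_sq_le hα₂ hf fun t ht => ?_) ?_
  · have h2 := le_norm_neg_one_sub_seg ⟨ht.1.le, ht.2.le⟩ 0
    rw [norm_zero] at h2
    simpa using hsmall t ht 0 (mem_ball_self one_pos) (by linarith [ht.2])
  · calc _ ≤ _ := lintegral_diskMeasure_mono hpt
      _ = (2 * (∫⁻ z, ‖g z‖ₑ ^ 2 ∂diskMeasure α) +
          2 * (∫⁻ z, ‖segMean 1 g z‖ₑ ^ 2 ∂diskMeasure α)) +
          (2 * (∫⁻ z, X z ^ 2 ∂diskMeasure α) + 2 * (∫⁻ z, Y z ^ 2 ∂diskMeasure α)) := by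
        rw [lintegral_add_left' (by fun_prop), lintegral_add_left' (by fun_prop),
          lintegral_add_left' (by fun_prop),
          lintegral_const_mul' _ _ (by simp), lintegral_const_mul' _ _ (by simp),
          lintegral_const_mul' _ _ (by simp), lintegral_const_mul' _ _ (by simp)]
      _ ≤ (2 * (C * S) + 2 * (A * (B * (C * S) + D * S * V))) +
          (2 * (A * S) + 2 * (A * (D * S * V))) := by gcongr
      _ = _ := by ring

end opJ

/-! ### The trace on a radius. -/

section trace

/-- A point `w` with `|1 - w| = ρ` lies in the disc of radius `s / 2` about `1 - s` only for `s`
comparable to `ρ`, and such an interval has bounded mass for `ds / s`. -/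
lemma lintegral_inv_indicator_le {ρ : ℝ} (hρ : 0 < ρ) {A : Set ℝ}
    (hA : A ⊆ Set.Ioo (2 / 3 * ρ) (2 * ρ)) :
    ∫⁻ s in Set.Ioo (0 : ℝ) 1, A.indicator (fun s => ENNReal.ofReal s⁻¹) s ≤ 2 := by
  calc _ ≤ ∫⁻ s, A.indicator (fun s => ENNReal.ofReal s⁻¹) s := setLIntegral_le_lintegral _ _
    _ ≤ ∫⁻ s, (Set.Ioo (2 / 3 * ρ) (2 * ρ)).indicator
          (fun _ => ENNReal.ofReal (3 / 2 * ρ⁻¹)) s := by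
        refine lintegral_mono fun s => ?_
        by_cases hs : s ∈ A
        · rw [Set.indicator_of_mem hs, Set.indicator_of_mem (hA hs)]
          refine ENNReal.ofReal_le_ofReal ?_
          refine (inv_anti₀ (by positivity) (hA hs).1.le).trans (le_of_eq ?_)
          rw [mul_inv]; norm_num
        · rw [Set.indicator_of_notMem hs]; positivity
    _ = 2 := by
        rw [lintegral_indicator measurableSet_Ioo, setLIntegral_const, Real.volume_Ioo,
          ← ENNReal.ofReal_mul (by positivity)]
        rw [show 3 / 2 * ρ⁻¹ * (2 * ρ - 2 / 3 * ρ) = 2 by field_simp; norm_num]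
        norm_num

lemma mem_ball_one_sub {s : ℝ} (hs : s ∈ Set.Ioo (0 : ℝ) 1) {w : ℂ}
    (hw : ‖w - (1 - (s : ℂ))‖ < s / 2) :
    s / 2 < 1 - ‖w‖ ∧ s / 2 < ‖1 - w‖ ∧ ‖1 - w‖ < 3 / 2 * s := by
  have h1 : ‖(1 - (s : ℂ))‖ = 1 - s := by
    rw [← Complex.ofReal_one, ← Complex.ofReal_sub, Complex.norm_real,
      Real.norm_of_nonneg (by linarith [hs.2])]
  have h2 := norm_le_norm_add_norm_sub' w (1 - (s : ℂ))
  have h3 : ‖(s : ℂ)‖ = s := by rw [Complex.norm_real, Real.norm_of_nonneg hs.1.le]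
  have h4 : ‖1 - w‖ ≤ ‖(s : ℂ)‖ + ‖w - (1 - (s : ℂ))‖ := by
    rw [show 1 - w = s - (w - (1 - (s : ℂ))) by ring]
    exact norm_sub_le _ _
  have h5 : ‖(s : ℂ)‖ ≤ ‖1 - w‖ + ‖w - (1 - (s : ℂ))‖ := by
    refine le_trans (le_of_eq ?_) (norm_add_le _ _)
    congr 1; ring
  exact ⟨by linarith, by linarith, by linarith⟩

lemma one_sub_mem_ball {s : ℝ} (hs : s ∈ Set.Ioo (0 : ℝ) 1) : 1 - (s : ℂ) ∈ ball (0 : ℂ) 1 := by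
  rw [mem_ball_zero_iff, ← Complex.ofReal_one, ← Complex.ofReal_sub, Complex.norm_real,
    Real.norm_of_nonneg (by linarith [hs.2])]
  linarith [hs.1]

/-- Sub-mean value property on the disc of radius `s / 2` about `1 - s`. There `1 - |w| > s / 2` and
`|1 - w| < 3 s / 2`, whence the factors `2 ^ α` and `9 / 4`; the remaining `4` comes from the area
`π s² / 4`. -/
lemma radial_sq_le {α : ℝ} (hα : 0 < α) {f : ℂ → ℂ} (hf : DifferentiableOn ℂ f (ball 0 1)) {s : ℝ}
    (hs : s ∈ Set.Ioo (0 : ℝ) 1) :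
    ‖f (1 - s)‖ₑ ^ 2 * ENNReal.ofReal (s ^ (α - 1)) ≤
      ENNReal.ofReal (9 * 2 ^ α) * ∫⁻ w, {s : ℝ | ‖w - (1 - (s : ℂ))‖ < s / 2}.indicator
        (fun s => ENNReal.ofReal s⁻¹) s * ‖f w / (1 - w)‖ₑ ^ 2 ∂diskMeasure α := by
  have hs0 := hs.1
  have hmem : ∀ w ∈ ball (1 - (s : ℂ)) (s / 2), ‖w - (1 - (s : ℂ))‖ < s / 2 := fun w hw => by
    simpa [dist_eq_norm] using hw
  have hsub : ball (1 - (s : ℂ)) (s / 2) ⊆ ball 0 1 := fun w hw => by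
    have := (mem_ball_one_sub hs (hmem w hw)).1
    rw [mem_ball_zero_iff]; linarith
  have h1 := volume_mul_enorm_sq_le (hf.mono hsub)
  rw [volume_ball_complex _ (by positivity)] at h1
  have h2 : ENNReal.ofReal (s ^ (α - 3)) * (ENNReal.ofReal (Real.pi * (s / 2) ^ 2) *
      ‖f (1 - s)‖ₑ ^ 2) ≤ ENNReal.ofReal (9 / 4 * 2 ^ α) *
      ∫⁻ w, {s : ℝ | ‖w - (1 - (s : ℂ))‖ < s / 2}.indicator
        (fun s => ENNReal.ofReal s⁻¹) s * ‖f w / (1 - w)‖ₑ ^ 2 ∂diskMeasure α := by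
    refine (mul_le_mul_right h1 _).trans ?_
    rw [lintegral_diskMeasure, ← lintegral_const_mul' _ _ ENNReal.ofReal_ne_top,
      ← lintegral_const_mul' _ _ ENNReal.ofReal_ne_top]
    refine le_trans (lintegral_mono_ae ?_) (lintegral_mono_set hsub)
    filter_upwards [ae_restrict_mem measurableSet_ball] with w hw
    obtain ⟨h3, h4, h5⟩ := mem_ball_one_sub hs (hmem w hw)
    have hρ : 0 < ‖1 - w‖ := by linarith
    rw [Set.indicator_of_mem (show s ∈ {s : ℝ | ‖w - (1 - (s : ℂ))‖ < s / 2} from hmem w hw),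
      ← ofReal_norm, ← ofReal_norm, ← ENNReal.ofReal_pow (norm_nonneg _),
      ← ENNReal.ofReal_pow (norm_nonneg _), ← ENNReal.ofReal_mul (by positivity),
      ← ENNReal.ofReal_mul (by positivity),
      ← ENNReal.ofReal_mul (Real.rpow_nonneg (by linarith) _), ← ENNReal.ofReal_mul (by positivity)]
    refine ENNReal.ofReal_le_ofReal ?_
    have h6 : s ^ α ≤ 2 ^ α * (1 - ‖w‖) ^ α := by
      rw [← Real.mul_rpow (by norm_num) (by linarith)]
      exact Real.rpow_le_rpow hs0.le (by linarith) hα.le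
    have h7 : (s ^ 2)⁻¹ ≤ 9 / 4 * (‖1 - w‖ ^ 2)⁻¹ := by
      rw [← div_eq_mul_inv, inv_eq_one_div, div_le_div_iff₀ (by positivity) (by positivity)]
      nlinarith
    have h8 : s ^ (α - 3) = s ^ α * (s ^ 2)⁻¹ * s⁻¹ := by
      rw [Real.rpow_sub hs0, show (3 : ℝ) = ((3 : ℕ) : ℝ) by norm_num, Real.rpow_natCast]
      field_simp
    rw [h8, norm_div, div_pow]
    calc _ ≤ (2 ^ α * (1 - ‖w‖) ^ α) * (9 / 4 * (‖1 - w‖ ^ 2)⁻¹) * s⁻¹ * ‖f w‖ ^ 2 := by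
          gcongr
          exact (Real.rpow_nonneg hs0.le _).trans h6
      _ = _ := by ring
  calc _ ≤ 4 * (ENNReal.ofReal (s ^ (α - 3)) * (ENNReal.ofReal (Real.pi * (s / 2) ^ 2) *
        ‖f (1 - s)‖ₑ ^ 2)) := by
        rw [← ofReal_norm, ← ENNReal.ofReal_pow (norm_nonneg _),
          ← ENNReal.ofReal_mul (by positivity), ← ENNReal.ofReal_mul (by positivity),
          ← ENNReal.ofReal_mul (by positivity), ← ENNReal.ofReal_ofNat,
          ← ENNReal.ofReal_mul (by positivity)]
        refine ENNReal.ofReal_le_ofReal ?_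
        have h8 : s ^ (α - 1) = s ^ (α - 3) * s ^ 2 := by
          rw [← Real.rpow_two, ← Real.rpow_add hs0]; ring_nf
        rw [h8]
        have : 0 ≤ ‖f (1 - s)‖ ^ 2 * (s ^ (α - 3) * s ^ 2) := by positivity
        nlinarith [Real.pi_gt_three]
    _ ≤ _ := mul_le_mul_right h2 _
    _ = _ := by
        rw [← mul_assoc, ← ENNReal.ofReal_ofNat, ← ENNReal.ofReal_mul (by norm_num)]
        congr 2; ring

/-- The restriction of a function in `D_α` to a radius. -/
lemma exists_lintegral_radial_le {α : ℝ} (hα₀ : 0 < α) (hα₂ : α < 2) :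
    ∃ C : ℝ≥0∞, C ≠ ∞ ∧ ∀ f ∈ Space α,
      ∫⁻ s in Set.Ioo (0 : ℝ) 1, ‖f (1 - s)‖ₑ ^ 2 * ENNReal.ofReal (s ^ (α - 1)) ≤
        C * sqNorm α f := by
  obtain ⟨C, hC, hardy⟩ := exists_lintegral_div_one_sub_le hα₀ hα₂
  refine ⟨ENNReal.ofReal (9 * 2 ^ α) * (2 * C), by finiteness, fun f hf => ?_⟩
  have hgm := aemeasurable_diskMeasure α (differentiableOn_div_one_sub hf.1).continuousOn
  have hk : Measurable fun x : ℝ × ℂ => {s : ℝ | ‖x.2 - (1 - (s : ℂ))‖ < s / 2}.indicator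
      (fun s => ENNReal.ofReal s⁻¹) x.1 := by
    have hset : MeasurableSet {x : ℝ × ℂ | ‖x.2 - (1 - (x.1 : ℂ))‖ < x.1 / 2} :=
      measurableSet_lt (by fun_prop) (by fun_prop)
    exact Measurable.indicator (f := fun x : ℝ × ℂ => ENNReal.ofReal x.1⁻¹) (by fun_prop) hset
  have hm : AEMeasurable (Function.uncurry fun (s : ℝ) (w : ℂ) =>
      {s : ℝ | ‖w - (1 - (s : ℂ))‖ < s / 2}.indicator
        (fun s => ENNReal.ofReal s⁻¹) s * ‖f w / (1 - w)‖ₑ ^ 2)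
      ((volume.restrict (Set.Ioo 0 1)).prod (diskMeasure α)) :=
    hk.aemeasurable.mul ((hgm.enorm.pow_const 2).comp_quasiMeasurePreserving
      Measure.quasiMeasurePreserving_snd)
  calc _ ≤ ∫⁻ s in Set.Ioo (0 : ℝ) 1, ENNReal.ofReal (9 * 2 ^ α) *
        ∫⁻ w, {s : ℝ | ‖w - (1 - (s : ℂ))‖ < s / 2}.indicator
          (fun s => ENNReal.ofReal s⁻¹) s * ‖f w / (1 - w)‖ₑ ^ 2 ∂diskMeasure α :=
        lintegral_mono_ae ((ae_restrict_mem measurableSet_Ioo).mono fun s hs =>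
          radial_sq_le hα₀ hf.1 hs)
    _ ≤ ENNReal.ofReal (9 * 2 ^ α) * ∫⁻ w, 2 * ‖f w / (1 - w)‖ₑ ^ 2 ∂diskMeasure α := by
        -- After Tonelli the inner integral over `s` is at most `2`, uniformly in `w`, and Hardy's
        -- integral remains.
        rw [lintegral_const_mul' _ _ ENNReal.ofReal_ne_top, lintegral_lintegral_swap hm]
        refine mul_le_mul_right (?_ : _ ≤ _) _
        refine lintegral_diskMeasure_mono fun w hw => ?_
        rw [lintegral_mul_const' _ _ (by simp)]
        gcongr
        have hρ : 0 < ‖1 - w‖ := norm_pos_iff.2 (one_sub_ne_zero hw)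
        calc _ = ∫⁻ s in Set.Ioo (0 : ℝ) 1,
              ({s : ℝ | ‖w - (1 - (s : ℂ))‖ < s / 2} ∩ Set.Ioo 0 1).indicator
                (fun s => ENNReal.ofReal s⁻¹) s := by
              refine setLIntegral_congr_fun measurableSet_Ioo fun s hs => ?_
              simp only [Set.indicator_apply, Set.mem_inter_iff, hs, and_true]
          _ ≤ 2 := lintegral_inv_indicator_le hρ fun s hs => by
              obtain ⟨h3, h4, h5⟩ := mem_ball_one_sub hs.2 hs.1
              exact ⟨by linarith, by linarith⟩
    _ ≤ ENNReal.ofReal (9 * 2 ^ α) * (2 * (C * sqNorm α f)) := by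
        rw [lintegral_const_mul' _ _ (by simp)]
        gcongr
        exact hardy f hf
    _ = _ := by ring

end trace

/-! ### Test integrals for the kernel `(s + |1 - z|)^(-2)`. -/

section kernel

/-- Split at `s = ρ`: below it, replace `s + ρ` by `ρ`; above it, replace `s + ρ` by `s` and `s ^
(-β)` by `ρ ^ (-β)`. -/
lemma lintegral_rpow_mul_kernel_le {β : ℝ} (hβ₀ : 0 < β) (hβ₁ : β < 1) {ρ : ℝ} (hρ : 0 < ρ) :
    ∫⁻ s in Set.Ioo (0 : ℝ) 1, ENNReal.ofReal (s ^ (-β) * ((s + ρ) ^ 2)⁻¹) ≤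
      ENNReal.ofReal ((1 / (1 - β) + 1) * ρ ^ (-β - 1)) := by
  have h1 : ∫⁻ s in Set.Ioc (0 : ℝ) ρ, ENNReal.ofReal (s ^ (-β) * ((s + ρ) ^ 2)⁻¹) ≤
      ENNReal.ofReal (1 / (1 - β) * ρ ^ (-β - 1)) := by
    have hi : IntegrableOn (fun s : ℝ => s ^ (-β)) (Set.Ioc 0 ρ) :=
      (intervalIntegrable_iff_integrableOn_Ioc_of_le hρ.le).1
        (intervalIntegral.intervalIntegrable_rpow' (by linarith))
    calc _ ≤ ∫⁻ s in Set.Ioc (0 : ℝ) ρ, ENNReal.ofReal (s ^ (-β) * (ρ ^ 2)⁻¹) := by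
          refine lintegral_mono_ae ?_
          filter_upwards [ae_restrict_mem measurableSet_Ioc] with s hs
          have hs0 := hs.1
          gcongr
          linarith
      _ = ENNReal.ofReal (∫ s in Set.Ioc (0 : ℝ) ρ, s ^ (-β) * (ρ ^ 2)⁻¹) :=
          (ofReal_integral_eq_lintegral_ofReal (hi.mul_const _)
            ((ae_restrict_mem measurableSet_Ioc).mono fun s hs =>
              mul_nonneg (Real.rpow_nonneg hs.1.le _) (by positivity))).symm
      _ = _ := by
          rw [integral_mul_const, ← intervalIntegral.integral_of_le hρ.le,
            integral_rpow (Or.inl (by linarith)), Real.zero_rpow (by linarith), sub_zero,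
            Real.rpow_sub hρ, Real.rpow_add hρ, Real.rpow_one, neg_add_eq_sub]
          congr 1
          field_simp
  have h2 : ∫⁻ s in Set.Ioi ρ, ENNReal.ofReal (s ^ (-β) * ((s + ρ) ^ 2)⁻¹) ≤
      ENNReal.ofReal (ρ ^ (-β - 1)) := by
    have hi : IntegrableOn (fun s : ℝ => s ^ (-2 : ℝ)) (Set.Ioi ρ) :=
      integrableOn_Ioi_rpow_of_lt (by norm_num) hρ
    calc _ ≤ ∫⁻ s in Set.Ioi ρ, ENNReal.ofReal (ρ ^ (-β) * s ^ (-2 : ℝ)) := by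
          refine lintegral_mono_ae ?_
          filter_upwards [ae_restrict_mem measurableSet_Ioi] with s hs
          have hs' : ρ < s := hs
          have hs0 : 0 < s := hρ.trans hs'
          rw [Real.rpow_neg hs0.le 2, Real.rpow_two]
          refine ENNReal.ofReal_le_ofReal (mul_le_mul
            (Real.rpow_le_rpow_of_nonpos hρ hs'.le (by linarith)) ?_ (by positivity)
            (by positivity))
          gcongr
          linarith
      _ = ENNReal.ofReal (∫ s in Set.Ioi ρ, ρ ^ (-β) * s ^ (-2 : ℝ)) :=
          (ofReal_integral_eq_lintegral_ofReal (hi.const_mul _)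
            ((ae_restrict_mem measurableSet_Ioi).mono fun s hs =>
              mul_nonneg (by positivity) (Real.rpow_nonneg (hρ.trans hs).le _))).symm
      _ = _ := by
          rw [integral_const_mul, integral_Ioi_rpow_of_lt (by norm_num) hρ, Real.rpow_sub hρ,
            Real.rpow_one, show (-2 : ℝ) + 1 = -1 by norm_num, Real.rpow_neg_one]
          congr 1
          field_simp
  calc _ ≤ ∫⁻ s in Set.Ioc 0 ρ ∪ Set.Ioi ρ, ENNReal.ofReal (s ^ (-β) * ((s + ρ) ^ 2)⁻¹) :=
        lintegral_mono_set fun s hs => by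
          rcases le_or_gt s ρ with h | h
          · exact Or.inl ⟨hs.1, h⟩
          · exact Or.inr h
    _ ≤ _ := lintegral_union_le _ _ _
    _ ≤ _ := add_le_add h1 h2
    _ = _ := by
        have : 0 < 1 - β := by linarith
        rw [← ENNReal.ofReal_add (by positivity) (by positivity)]
        congr 1; ring

/-- The integrand behaves like `|z| ^ (β - 1)` at the origin and `|z| ^ (β - 3)` at infinity; the
latter is integrable in the plane since `β < 1`. -/
lemma lintegral_planar_kernel_lt_top {β : ℝ} (hβ₀ : 0 < β) (hβ₁ : β < 1) :
    ∫⁻ z : ℂ, ENNReal.ofReal (‖z‖ ^ (β - 1) * ((1 + ‖z‖) ^ 2)⁻¹) < ∞ := by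
  rw [← lintegral_add_compl _ (measurableSet_ball (x := (0 : ℂ)) (ε := 1))]
  refine ENNReal.add_lt_top.2 ⟨?_, ?_⟩
  · refine lt_of_le_of_lt (lintegral_mono fun z => ?_)
      (lintegral_ball_rpow_lt_top (γ := β - 1) (by linarith) 1)
    refine ENNReal.ofReal_le_ofReal (mul_le_of_le_one_right (by positivity) ?_)
    exact inv_le_one_of_one_le₀ (one_le_pow₀ (by linarith [norm_nonneg z]))
  · have hi := (integrable_one_add_norm (E := ℂ) (μ := volume) (r := 3 - β)
      (by simp; linarith)).const_mul (2 ^ (1 - β))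
    have hfin := (hasFiniteIntegral_iff_ofReal (Filter.Eventually.of_forall fun z => by
      positivity)).1 hi.2
    refine lt_of_le_of_lt ?_ hfin
    refine le_trans (lintegral_mono_ae ?_) (setLIntegral_le_lintegral (ball (0 : ℂ) 1)ᶜ _)
    filter_upwards [ae_restrict_mem measurableSet_ball.compl] with z hz
    have hz1 : 1 ≤ ‖z‖ := by simpa using hz
    refine ENNReal.ofReal_le_ofReal ?_
    have h1 : ‖z‖ ^ (β - 1) ≤ ((1 + ‖z‖) / 2) ^ (β - 1) :=
      Real.rpow_le_rpow_of_nonpos (by positivity) (by linarith) (by linarith)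
    calc _ ≤ ((1 + ‖z‖) / 2) ^ (β - 1) * ((1 + ‖z‖) ^ 2)⁻¹ := by gcongr
      _ = _ := by
        rw [Real.div_rpow (by positivity) (by norm_num), show -(3 - β) = (β - 1) + (-2) by ring,
          Real.rpow_add (by positivity), Real.rpow_neg (by positivity) 2, Real.rpow_two,
          show 1 - β = -(β - 1) by ring, Real.rpow_neg (by norm_num) (β - 1)]
        ring

lemma lintegral_planar_kernel_scale {β : ℝ} {s : ℝ} (hs : 0 < s) :
    ∫⁻ z : ℂ, ENNReal.ofReal (‖z‖ ^ (β - 1) * ((s + ‖z‖) ^ 2)⁻¹) ≤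
      ENNReal.ofReal (s ^ (β - 1)) *
        ∫⁻ z : ℂ, ENNReal.ofReal (‖z‖ ^ (β - 1) * ((1 + ‖z‖) ^ 2)⁻¹) := by
  have hsc : (s : ℂ) ≠ 0 := by exact_mod_cast hs.ne'
  have hder : ∀ z : ℂ, HasDerivAt (fun z : ℂ => z / s) (1 / s) z := fun z =>
    (hasDerivAt_id z).div_const (s : ℂ)
  have h := lintegral_comp_mul_deriv_sq_le (φ := fun z : ℂ => z / s) (U := Set.univ)
    (V := Set.univ) isOpen_univ
    (fun z _ => (hder z).differentiableAt.differentiableWithinAt)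
    (fun z _ w _ hzw => by simpa [div_left_inj' hsc] using hzw) (fun _ _ => Set.mem_univ _)
    (fun z => ENNReal.ofReal (‖z‖ ^ (β - 1) * ((1 + ‖z‖) ^ 2)⁻¹))
  rw [setLIntegral_univ, setLIntegral_univ] at h
  refine le_trans (le_of_eq ?_) (mul_le_mul_right h _)
  rw [← lintegral_const_mul' _ _ ENNReal.ofReal_ne_top]
  refine lintegral_congr fun z => ?_
  rw [(hder z).deriv, ← ofReal_norm, ← ENNReal.ofReal_pow (norm_nonneg _),
    ← ENNReal.ofReal_mul (by positivity), ← ENNReal.ofReal_mul (by positivity), norm_div, norm_div,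
    Complex.norm_real, Real.norm_of_nonneg hs.le, Real.div_rpow (norm_nonneg _) hs.le]
  congr 1
  have : 0 < s ^ (β - 1) := by positivity
  rw [norm_one]
  field_simp

/-- Bounding the weight by `|1 - z| ^ α` and centring at `1` reduces this to the scaled planar
integral with `β = α / 2`. -/
lemma lintegral_diskMeasure_kernel_le {α : ℝ} (hα₀ : 0 < α) {s : ℝ} (hs : 0 < s) :
    ∫⁻ z, ENNReal.ofReal (‖1 - z‖ ^ (-(α / 2) - 1) * ((s + ‖1 - z‖) ^ 2)⁻¹) ∂diskMeasure α ≤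
      ENNReal.ofReal (s ^ (α / 2 - 1)) *
        ∫⁻ z : ℂ, ENNReal.ofReal (‖z‖ ^ (α / 2 - 1) * ((1 + ‖z‖) ^ 2)⁻¹) := by
  refine le_trans ?_ (lintegral_planar_kernel_scale hs)
  rw [lintegral_diskMeasure, ← lintegral_sub_left_eq_self (μ := volume)
    (fun z : ℂ => ENNReal.ofReal (‖z‖ ^ (α / 2 - 1) * ((s + ‖z‖) ^ 2)⁻¹)) 1]
  refine le_trans (lintegral_mono_ae ?_) (setLIntegral_le_lintegral (ball (0 : ℂ) 1) _)
  filter_upwards [ae_restrict_mem measurableSet_ball] with z hz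
  have hz1 : 0 < 1 - ‖z‖ := by simpa using hz
  have hρ : 0 < ‖1 - z‖ := norm_pos_iff.2 (one_sub_ne_zero hz)
  rw [← ENNReal.ofReal_mul (by positivity), ← mul_assoc]
  gcongr ENNReal.ofReal (?_ * _)
  calc _ ≤ ‖1 - z‖ ^ α * ‖1 - z‖ ^ (-(α / 2) - 1) := by
        gcongr; exact one_sub_norm_le z
    _ = _ := by rw [← Real.rpow_add hρ]; ring_nf

end kernel

/-! ### The Hilbert and reduced Hilbert operators. -/

/-- The Hilbert operator in the variable `s = 1 - t`. -/
noncomputable def hilbertMean (f : ℂ → ℂ) (z : ℂ) : ℂ :=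
  ∫ s in Set.Ioo (0 : ℝ) 1, f (1 - s) / (1 - (1 - s) * z)

lemma norm_radial_le {α : ℝ} (hα : 0 < α) {f : ℂ → ℂ} (hf : f ∈ Space α) {s : ℝ}
    (hs : s ∈ Set.Ioo (0 : ℝ) 1) :
    ‖f (1 - s)‖ ≤ growthConst α * norm α f * s ^ (-(α / 2)) := by
  have h := norm_seg_le hα hf (p := 1) (by simp) hs (mem_ball_self one_pos)
  rw [show (1 : ℂ) + s * (0 - 1) = 1 - s by ring] at h
  simpa using h

lemma le_norm_hilbert_denom {s : ℝ} (hs : s ∈ Set.Ioo (0 : ℝ) 1) (z : ℂ) :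
    1 - (1 - s) * ‖z‖ ≤ ‖1 - (1 - (s : ℂ)) * z‖ := le_norm_one_sub_mul ⟨hs.1.le, hs.2.le⟩ z

lemma hilbert_denom_ne_zero {s : ℝ} (hs : s ∈ Set.Ioo (0 : ℝ) 1) {z : ℂ}
    (hz : z ∈ ball (0 : ℂ) 1) : 1 - (1 - (s : ℂ)) * z ≠ 0 :=
  norm_pos_iff.1 (one_sub_mul_pos ⟨hs.1.le, hs.2.le⟩ (by simpa using hz))

lemma continuousOn_radial {f : ℂ → ℂ} (hf : DifferentiableOn ℂ f (ball 0 1)) :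
    ContinuousOn (fun s : ℝ => f (1 - s)) (Set.Ioo 0 1) :=
  hf.continuousOn.comp (by fun_prop) fun _ hs => one_sub_mem_ball hs

lemma hilbertMean_hasDerivAt {α : ℝ} (hα₀ : 0 < α) (hα₂ : α < 2) {f : ℂ → ℂ} (hf : f ∈ Space α)
    {z : ℂ} (hz : z ∈ ball (0 : ℂ) 1) :
    IntegrableOn (fun s : ℝ => f (1 - s) / (1 - (1 - s) * z)) (Set.Ioo 0 1) ∧
    HasDerivAt (hilbertMean f) (∫ s in Set.Ioo (0 : ℝ) 1,
      f (1 - s) * (1 - s) / (1 - (1 - s) * z) ^ 2) z := by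
  have hc := continuousOn_radial hf.1
  have h := hasDerivAt_setIntegral_of_norm_le (F := fun s z => f (1 - s) / (1 - (1 - s) * z))
    (F' := fun s z => f (1 - s) * (1 - s) / (1 - (1 - s) * z) ^ 2)
    (fun w hw => hc.div (by fun_prop) fun s hs => hilbert_denom_ne_zero hs hw)
    (fun w hw => (hc.mul (by fun_prop)).div (by fun_prop) fun s hs =>
      pow_ne_zero 2 (hilbert_denom_ne_zero hs hw))
    (fun s hs w hw => ?_) (fun r hr => ?_) hz
  · exact ⟨h.1, h.2.2⟩
  · have hne := hilbert_denom_ne_zero hs hw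
    refine ((hasDerivAt_const w (f (1 - s))).div
      (((hasDerivAt_id w).const_mul (1 - (s : ℂ))).const_sub 1) hne).congr_deriv ?_
    simp only [id]
    ring
  · refine ⟨_, integrableOn_Ioo_rpow (a := α / 2) (by linarith)
      (growthConst α * norm α f / (1 - r)), fun s hs w hw => ?_⟩
    have hg := growthConst_pos hα₀
    have hN := norm_nonneg' α f
    have h1 := norm_radial_le hα₀ hf hs
    have h2 : 1 - r ≤ ‖1 - (1 - (s : ℂ)) * w‖ := by
      refine le_trans ?_ (le_norm_hilbert_denom hs w)
      nlinarith [hs.1, hs.2, norm_nonneg w]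
    rw [norm_div, div_mul_eq_mul_div]
    have h3 : 0 < 1 - r := by linarith
    exact div_le_div₀ ((norm_nonneg _).trans h1) h1 h3 h2

lemma differentiableOn_hilbertMean {α : ℝ} (hα₀ : 0 < α) (hα₂ : α < 2) {f : ℂ → ℂ}
    (hf : f ∈ Space α) : DifferentiableOn ℂ (hilbertMean f) (ball 0 1) := fun _ hz =>
  (hilbertMean_hasDerivAt hα₀ hα₂ hf hz).2.differentiableAt.differentiableWithinAt

/-- With `A = |1 - (1 - s) z|` one has `s ≤ A` and `|1 - z| ≤ A + s |z| ≤ 2 A`, so `s + |1 - z| ≤ 3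
A`; the constant is `3²`. -/
lemma enorm_deriv_hilbertMean_le {α : ℝ} (hα₀ : 0 < α) (hα₂ : α < 2) {f : ℂ → ℂ}
    (hf : f ∈ Space α) {z : ℂ} (hz : z ∈ ball (0 : ℂ) 1) :
    ‖deriv (hilbertMean f) z‖ₑ ≤ ENNReal.ofReal 9 * ∫⁻ s in Set.Ioo (0 : ℝ) 1,
      ‖f (1 - s)‖ₑ * ENNReal.ofReal ((s + ‖1 - z‖) ^ 2)⁻¹ := by
  have hz1 : ‖z‖ < 1 := by simpa using hz
  rw [(hilbertMean_hasDerivAt hα₀ hα₂ hf hz).2.deriv,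
    ← lintegral_const_mul' _ _ ENNReal.ofReal_ne_top]
  refine (enorm_integral_le_lintegral_enorm _).trans (lintegral_mono_ae ?_)
  filter_upwards [ae_restrict_mem measurableSet_Ioo] with s hs
  have hs0 := hs.1
  rw [← ofReal_norm, ← ofReal_norm, ← ENNReal.ofReal_mul (by positivity),
    ← ENNReal.ofReal_mul (by norm_num)]
  refine ENNReal.ofReal_le_ofReal ?_
  have hd := le_norm_hilbert_denom hs z
  set A := ‖1 - (1 - (s : ℂ)) * z‖ with hA
  have h1 : s ≤ A := by nlinarith [hs.2, norm_nonneg z]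
  have h2 : ‖1 - z‖ ≤ A + s * ‖z‖ := by
    rw [show 1 - z = (1 - (1 - (s : ℂ)) * z) - s * z by ring]
    refine (norm_sub_le _ _).trans (le_of_eq ?_)
    rw [norm_mul, Complex.norm_real, Real.norm_of_nonneg hs0.le]
  have h3 : s + ‖1 - z‖ ≤ 3 * A := by nlinarith
  have hA0 : 0 < A := hs0.trans_le h1
  have h4 : ‖1 - (s : ℂ)‖ ≤ 1 := by
    have := one_sub_mem_ball hs
    rw [mem_ball_zero_iff] at this
    exact this.le
  have h5 : (A ^ 2)⁻¹ ≤ 9 * ((s + ‖1 - z‖) ^ 2)⁻¹ := by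
    have h6 : (s + ‖1 - z‖) ^ 2 ≤ 9 * A ^ 2 :=
      (pow_le_pow_left₀ (by positivity) h3 2).trans (le_of_eq (by ring))
    rw [← div_eq_mul_inv, inv_eq_one_div, div_le_div_iff₀ (by positivity) (by positivity)]
    linarith
  rw [norm_div, norm_mul, norm_pow, ← hA, div_eq_mul_inv]
  calc _ ≤ ‖f (1 - s)‖ * 1 * (9 * ((s + ‖1 - z‖) ^ 2)⁻¹) := by gcongr
    _ = _ := by ring

/-- The Hilbert operator is bounded on `D_α`. -/
lemma exists_sqNorm_hilbertMean_le {α : ℝ} (hα₀ : 0 < α) (hα₂ : α < 2) :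
    ∃ C : ℝ≥0∞, C ≠ ∞ ∧ ∀ f ∈ Space α, sqNorm α (hilbertMean f) ≤ C * sqNorm α f := by
  obtain ⟨C, hC, hrad⟩ := exists_lintegral_radial_le hα₀ hα₂
  have hK₂ := lintegral_planar_kernel_lt_top (β := α / 2) (by linarith) (by linarith)
  set K₂ := ∫⁻ z : ℂ, ENNReal.ofReal (‖z‖ ^ (α / 2 - 1) * ((1 + ‖z‖) ^ 2)⁻¹)
  set k := 1 / (1 - α / 2) + 1 with hk
  have hk0 : 0 < k := by
    have : 0 < 1 - α / 2 := by linarith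
    positivity
  refine ⟨ENNReal.ofReal ((growthConst α / (1 - α / 2)) ^ 2) +
    ENNReal.ofReal 9 ^ 2 * (ENNReal.ofReal k * K₂ * C), by finiteness, fun f hf => ?_⟩
  rw [sqNorm, add_mul]
  refine add_le_add ?_ ?_
  · refine enorm_sq_le_of_norm_le hf ((norm_setIntegral_le_rpow (a := α / 2) (by linarith)
      (K := growthConst α * norm α f) fun s hs => ?_).trans (le_of_eq (by ring)))
    simpa using norm_radial_le hα₀ hf hs
  have hfm : AEMeasurable (fun s : ℝ => ‖f (1 - s)‖ₑ) (volume.restrict (Set.Ioo 0 1)) :=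
    ((continuousOn_radial hf.1).aemeasurable measurableSet_Ioo).enorm
  have hG : AEMeasurable (Function.uncurry fun (s : ℝ) (z : ℂ) =>
      ‖f (1 - s)‖ₑ * ENNReal.ofReal ((s + ‖1 - z‖) ^ 2)⁻¹)
      ((volume.restrict (Set.Ioo 0 1)).prod (diskMeasure α)) := by
    refine AEMeasurable.mul (hfm.comp_quasiMeasurePreserving
      Measure.quasiMeasurePreserving_fst) ?_
    fun_prop
  -- Schur weight: `s ^ (-α / 2)` times the kernel. What remains of the weight in `s` is `s ^ (α /
  -- 2)`, and the integral in `z` supplies `s ^ (α / 2 - 1)`; the product is the trace weight `s ^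
  -- (α - 1)`.
  have hschur := lintegral_sq_lintegral_le (ν := volume.restrict (Set.Ioo (0 : ℝ) 1))
    (μ := diskMeasure α)
    (G := fun (s : ℝ) (z : ℂ) => ‖f (1 - s)‖ₑ * ENNReal.ofReal ((s + ‖1 - z‖) ^ 2)⁻¹)
    (p := fun (s : ℝ) (z : ℂ) => ENNReal.ofReal (s ^ (-(α / 2)) * ((s + ‖1 - z‖) ^ 2)⁻¹))
    (P := fun z => ENNReal.ofReal (k * ‖1 - z‖ ^ (-(α / 2) - 1))) hG
    (by unfold Function.uncurry; fun_prop) (by fun_prop)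
    (Filter.Eventually.of_forall fun z => by
      filter_upwards [ae_restrict_mem measurableSet_Ioo] with s hs
      have hs0 := hs.1
      rw [ne_eq, ENNReal.ofReal_eq_zero, not_le]
      positivity)
    (Filter.Eventually.of_forall fun z => Filter.Eventually.of_forall fun s =>
      ENNReal.ofReal_ne_top)
    ((ae_diskMeasure_mem_ball α).mono fun z hz =>
      lintegral_rpow_mul_kernel_le (by linarith) (by linarith)
        (norm_pos_iff.2 (one_sub_ne_zero hz)))
  calc _ ≤ ∫⁻ z, ENNReal.ofReal 9 ^ 2 * (∫⁻ s in Set.Ioo (0 : ℝ) 1,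
        ‖f (1 - s)‖ₑ * ENNReal.ofReal ((s + ‖1 - z‖) ^ 2)⁻¹) ^ 2 ∂diskMeasure α := by
        refine lintegral_diskMeasure_mono fun z hz => ?_
        rw [← mul_pow]
        exact pow_le_pow_left' (enorm_deriv_hilbertMean_le hα₀ hα₂ hf hz) 2
    _ ≤ ENNReal.ofReal 9 ^ 2 * ∫⁻ s in Set.Ioo (0 : ℝ) 1, ENNReal.ofReal k * K₂ *
          (‖f (1 - s)‖ₑ ^ 2 * ENNReal.ofReal (s ^ (α - 1))) := by
        rw [lintegral_const_mul' _ _ (by finiteness)]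
        refine mul_le_mul_right (hschur.trans (lintegral_mono_ae ?_)) _
        filter_upwards [ae_restrict_mem measurableSet_Ioo] with s hs
        have hs0 := hs.1
        have e : ∀ z : ℂ, ENNReal.ofReal (k * ‖1 - z‖ ^ (-(α / 2) - 1)) *
            ((‖f (1 - s)‖ₑ * ENNReal.ofReal ((s + ‖1 - z‖) ^ 2)⁻¹) ^ 2 /
              ENNReal.ofReal (s ^ (-(α / 2)) * ((s + ‖1 - z‖) ^ 2)⁻¹)) =
            (ENNReal.ofReal k * ‖f (1 - s)‖ₑ ^ 2 * ENNReal.ofReal (s ^ (α / 2))) *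
              ENNReal.ofReal (‖1 - z‖ ^ (-(α / 2) - 1) * ((s + ‖1 - z‖) ^ 2)⁻¹) := fun z => by
          have hq : 0 < s + ‖1 - z‖ := by positivity
          rw [← ofReal_norm, ← ENNReal.ofReal_pow (norm_nonneg _),
            ← ENNReal.ofReal_mul (norm_nonneg _), ← ENNReal.ofReal_pow (by positivity),
            ← ENNReal.ofReal_div_of_pos (by positivity), ← ENNReal.ofReal_mul (by positivity),
            ← ENNReal.ofReal_mul (by positivity), ← ENNReal.ofReal_mul (by positivity),
            ← ENNReal.ofReal_mul (by positivity), Real.rpow_neg hs0.le]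
          congr 1
          have : 0 < s ^ (α / 2) := by positivity
          field_simp
        simp only [e]
        rw [lintegral_const_mul' _ _ (by finiteness)]
        refine (mul_le_mul_right (lintegral_diskMeasure_kernel_le hα₀ hs0) _).trans (le_of_eq ?_)
        have h1 : ENNReal.ofReal (s ^ (α - 1)) =
            ENNReal.ofReal (s ^ (α / 2)) * ENNReal.ofReal (s ^ (α / 2 - 1)) := by
          rw [← ENNReal.ofReal_mul (by positivity), ← Real.rpow_add hs0]
          ring_nf
        rw [h1]
        ring
    _ ≤ ENNReal.ofReal 9 ^ 2 * (ENNReal.ofReal k * K₂ * (C * sqNorm α f)) := by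
        rw [lintegral_const_mul' _ _ (by finiteness)]
        gcongr
        exact hrad f hf
    _ = _ := by ring

lemma sqNorm_half_add_le {α : ℝ} {g h : ℂ → ℂ} (hg : DifferentiableOn ℂ g (ball 0 1))
    (hh : DifferentiableOn ℂ h (ball 0 1)) :
    sqNorm α (fun z => 1 / 2 * (g z + h z)) ≤ 2 * sqNorm α g + 2 * sqNorm α h := by
  have key : ∀ a b : ℂ, ‖1 / 2 * (a + b)‖ₑ ^ 2 ≤ 2 * ‖a‖ₑ ^ 2 + 2 * ‖b‖ₑ ^ 2 := fun a b => by
    refine le_trans (pow_le_pow_left' (le_trans ?_ (enorm_add_le a b)) 2) (add_sq_le_two_mul _ _)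
    refine enorm_le_iff_norm_le.2 ?_
    rw [norm_mul]
    exact mul_le_of_le_one_left (norm_nonneg _) (by norm_num)
  have hm : Measurable (deriv g) := measurable_deriv g
  calc _ ≤ (2 * ‖g 0‖ₑ ^ 2 + 2 * ‖h 0‖ₑ ^ 2) +
        ∫⁻ z, (2 * ‖deriv g z‖ₑ ^ 2 + 2 * ‖deriv h z‖ₑ ^ 2) ∂diskMeasure α := by
        refine add_le_add (key _ _) (lintegral_diskMeasure_mono fun z hz => ?_)
        have h1 := (((hg.differentiableAt (isOpen_ball.mem_nhds hz)).hasDerivAt.add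
          (hh.differentiableAt (isOpen_ball.mem_nhds hz)).hasDerivAt).const_mul (1 / 2 : ℂ)).deriv
        have h2 : deriv (fun z => 1 / 2 * (g z + h z)) z = 1 / 2 * (deriv g z + deriv h z) := h1
        rw [h2]
        exact key _ _
    _ = _ := by
        rw [lintegral_add_left (by fun_prop), lintegral_const_mul' _ _ (by simp),
          lintegral_const_mul' _ _ (by simp), sqNorm, sqNorm]
        ring

/-- The reduced Hilbert operator in terms of the Hilbert operator and the reflection. -/
noncomputable def reducedHilbertMean (f : ℂ → ℂ) (z : ℂ) : ℂ :=
  1 / 2 * (hilbertMean f z + hilbertMean (fun w => f (-w)) (-z))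

lemma differentiableOn_reducedHilbertMean {α : ℝ} (hα₀ : 0 < α) (hα₂ : α < 2) {f : ℂ → ℂ}
    (hf : f ∈ Space α) : DifferentiableOn ℂ (reducedHilbertMean f) (ball 0 1) :=
  ((differentiableOn_hilbertMean hα₀ hα₂ hf).add (differentiableOn_comp_neg
    (differentiableOn_hilbertMean hα₀ hα₂ (comp_neg_mem_space hf)))).const_mul _

lemma exists_sqNorm_reducedHilbertMean_le {α : ℝ} (hα₀ : 0 < α) (hα₂ : α < 2) :
    ∃ C : ℝ≥0∞, C ≠ ∞ ∧ ∀ f ∈ Space α, sqNorm α (reducedHilbertMean f) ≤ C * sqNorm α f := by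
  obtain ⟨C, hC, h⟩ := exists_sqNorm_hilbertMean_le hα₀ hα₂
  refine ⟨2 * C + 2 * C, by finiteness, fun f hf => ?_⟩
  have hf' := comp_neg_mem_space hf
  refine (sqNorm_half_add_le (differentiableOn_hilbertMean hα₀ hα₂ hf)
    (differentiableOn_comp_neg (differentiableOn_hilbertMean hα₀ hα₂ hf'))).trans ?_
  rw [sqNorm_comp_neg α (hilbertMean fun w => f (-w))]
  have h2 := h _ hf'
  rw [sqNorm_comp_neg] at h2
  calc _ ≤ 2 * (C * sqNorm α f) + 2 * (C * sqNorm α f) := by gcongr; exact h f hf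
    _ = _ := by ring

/-! ### Identification of the operators with their models, and linearity. -/

lemma segmentIntegrable_iff {a b : ℂ} {g : ℂ → ℂ} :
    SegmentIntegrable a b g ↔
      IntegrableOn (fun t : ℝ => g (a + t * (b - a))) (Set.Ioo 0 1) := by
  rw [SegmentIntegrable, intervalIntegrable_iff_integrableOn_Ioo_of_le zero_le_one]

lemma segmentIntegral_eq (p z : ℂ) (g : ℂ → ℂ) :
    segmentIntegral p z g = (z - p) * segMean p g z := by
  rw [segmentIntegral, segMean, intervalIntegral.integral_of_le zero_le_one,
    integral_Ioc_eq_integral_Ioo]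

lemma segmentIntegral_linear {a b : ℂ} {F G H : ℂ → ℂ} {c : ℂ} (hF : SegmentIntegrable a b F)
    (hG : SegmentIntegrable a b G) (hH : ∀ ζ, H ζ = c * F ζ + G ζ) :
    segmentIntegral a b H = c * segmentIntegral a b F + segmentIntegral a b G := by
  simp only [segmentIntegral, hH]
  rw [intervalIntegral.integral_add (hF.const_mul c) hG, intervalIntegral.integral_const_mul]
  ring

/-- The mean form needs no case distinction: at `z = 0` the integrand is the constant `f 0`, which
is the prescribed value. -/
lemma cesaro_eq (f : ℂ → ℂ) (z : ℂ) : cesaro f z = segMean 0 (fun ζ => f ζ / (1 - ζ)) z := by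
  rw [cesaro]
  split_ifs with h
  · simp [segMean, h]
  · rw [segmentIntegral_eq, sub_zero, ← mul_assoc, one_div_mul_cancel h, one_mul]

lemma sub_one_ne_zero {z : ℂ} (hz : z ∈ ball (0 : ℂ) 1) : z - 1 ≠ 0 := by
  rw [← neg_sub]; exact neg_ne_zero.2 (one_sub_ne_zero hz)

lemma one_div_sub_one_mul_segmentIntegral {z : ℂ} (hz : z ∈ ball (0 : ℂ) 1) (g : ℂ → ℂ) :
    1 / (z - 1) * segmentIntegral 1 z g = segMean 1 g z := by
  rw [segmentIntegral_eq, ← mul_assoc, one_div_mul_cancel (sub_one_ne_zero hz), one_mul]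

lemma hilbert_eq (f : ℂ → ℂ) (z : ℂ) : hilbert f z = hilbertMean f z := by
  have h := intervalIntegral.integral_comp_sub_left (a := 0) (b := 1)
    (fun x : ℝ => f x / (1 - x * z)) 1
  rw [hilbertMean, ← integral_Ioc_eq_integral_Ioo, ← intervalIntegral.integral_of_le zero_le_one]
  simp only [sub_self, sub_zero] at h
  simp only [hilbert, segmentIntegral, sub_zero, one_mul, zero_add, mul_one]
  rw [← h]
  simp


lemma intervalIntegrable_hilbert {α : ℝ} (hα₀ : 0 < α) (hα₂ : α < 2) {f : ℂ → ℂ}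
    (hf : f ∈ Space α) {z : ℂ} (hz : z ∈ ball (0 : ℂ) 1) :
    IntervalIntegrable (fun x : ℝ => f x / (1 - x * z)) volume 0 1 := by
  have h := (intervalIntegrable_iff_integrableOn_Ioo_of_le zero_le_one).2
    (hilbertMean_hasDerivAt hα₀ hα₂ hf hz).1
  simpa using (h.comp_sub_left 1).symm

lemma intervalIntegrable_reducedHilbert {α : ℝ} (hα₀ : 0 < α) (hα₂ : α < 2) {f : ℂ → ℂ}
    (hf : f ∈ Space α) {z : ℂ} (hz : z ∈ ball (0 : ℂ) 1) :
    IntervalIntegrable (fun x : ℝ => f x / (1 - x * z)) volume (-1) 0 := by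
  have h := intervalIntegrable_hilbert hα₀ hα₂ (comp_neg_mem_space hf) (z := -z) (by simpa using hz)
  have h' := (IntervalIntegrable.iff_comp_neg (by simp)).1 h.symm
  simpa using h'

lemma segmentIntegrable_cesaro {α : ℝ} (hα₀ : 0 < α) {f : ℂ → ℂ}
    (hf : f ∈ Space α) {z : ℂ} (hz : z ∈ ball (0 : ℂ) 1) :
    SegmentIntegrable 0 z (fun ζ => f ζ / (1 - ζ)) :=
  segmentIntegrable_iff.2 (segMean_hasDerivAt (by simp) (differentiableOn_div_one_sub hf.1)
    (segBound_cesaro hα₀ hf) hz).1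

lemma segmentIntegrable_opA {α : ℝ} (hα₀ : 0 < α) (hα₂ : α < 2) {f : ℂ → ℂ}
    (hf : f ∈ Space α) {z : ℂ} (hz : z ∈ ball (0 : ℂ) 1) : SegmentIntegrable 1 z f :=
  segmentIntegrable_iff.2 (segMean_hasDerivAt (by simp) hf.1 (segBound_one hα₀ hα₂ hf) hz).1

lemma segmentIntegrable_opJ {α : ℝ} (hα₀ : 0 < α) (hα₂ : α < 2) {f : ℂ → ℂ}
    (hf : f ∈ Space α) {z : ℂ} (hz : z ∈ ball (0 : ℂ) 1) :
    SegmentIntegrable 1 z (fun ζ => f ζ / (-1 - ζ)) :=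
  segmentIntegrable_iff.2 (segMean_hasDerivAt (by simp) (differentiableOn_div_neg_one_sub hf.1)
    (segBound_opJ hα₀ hα₂ hf) hz).1

lemma segmentIntegrable_hilbert {α : ℝ} (hα₀ : 0 < α) (hα₂ : α < 2) {f : ℂ → ℂ}
    (hf : f ∈ Space α) {z : ℂ} (hz : z ∈ ball (0 : ℂ) 1) :
    SegmentIntegrable 0 1 (fun ζ => f ζ / (1 - ζ * z)) := by
  simpa [SegmentIntegrable] using intervalIntegrable_hilbert hα₀ hα₂ hf hz

lemma segmentIntegrable_reducedHilbert {α : ℝ} (hα₀ : 0 < α) (hα₂ : α < 2) {f : ℂ → ℂ}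
    (hf : f ∈ Space α) {z : ℂ} (hz : z ∈ ball (0 : ℂ) 1) :
    SegmentIntegrable (-1) 1 (fun ζ => f ζ / (1 - ζ * z)) := by
  have h := (intervalIntegrable_reducedHilbert hα₀ hα₂ hf hz).trans
    (intervalIntegrable_hilbert hα₀ hα₂ hf hz)
  -- Reparametrization `x = -1 + 2 t` of `[-1, 1]`.
  have h1 := (h.comp_add_left (-1)).comp_mul_left (c := 2)
  norm_num at h1
  rw [SegmentIntegrable]
  convert h1 using 4 <;> ring

lemma reducedHilbert_eq {α : ℝ} (hα₀ : 0 < α) (hα₂ : α < 2) {f : ℂ → ℂ}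
    (hf : f ∈ Space α) {z : ℂ} (hz : z ∈ ball (0 : ℂ) 1) :
    reducedHilbert f z = reducedHilbertMean f z := by
  set G : ℝ → ℂ := fun x => f x / (1 - x * z) with hG
  have h1 := intervalIntegral.integral_comp_add_mul (a := 0) (b := 1) G
    (c := 2) (by norm_num) (-1)
  rw [mul_zero, add_zero, mul_one, show (-1 : ℝ) + 2 = 1 by norm_num,
    ← intervalIntegral.integral_add_adjacent_intervals (f := G) (b := 0)
    (intervalIntegrable_reducedHilbert hα₀ hα₂ hf hz)
    (intervalIntegrable_hilbert hα₀ hα₂ hf hz)] at h1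
  have h2 := intervalIntegral.integral_comp_neg (a := 0) (b := 1) G
  rw [neg_zero] at h2
  rw [reducedHilbertMean, ← hilbert_eq, ← hilbert_eq, hilbert, hilbert, reducedHilbert,
    segmentIntegral, segmentIntegral, segmentIntegral]
  have e1 : ∀ t : ℝ, f (-1 + t * (1 - -1)) / (1 - (-1 + t * (1 - -1)) * z) = G (-1 + 2 * t) :=
    fun t => by
      simp only [hG]
      push_cast
      rw [show (-1 : ℂ) + t * (1 - -1) = -1 + 2 * t by ring]
  have e2 : ∀ t : ℝ, f (-(0 + t * (1 - 0))) / (1 - (0 + t * (1 - 0)) * -z) = G (-t) := fun t => by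
    simp [hG]
  have e3 : ∀ t : ℝ, f (0 + t * (1 - 0)) / (1 - (0 + t * (1 - 0)) * z) = G t := fun t => by
    simp [hG]
  simp only [e1, e2, e3, h1, h2, Complex.real_smul]
  push_cast
  ring

lemma cesaro_isBoundedOperator {α : ℝ} (hα₀ : 0 < α) (hα₂ : α < 2) :
    IsBoundedOperator α cesaro := by
  have e : ∀ f : ℂ → ℂ, cesaro f = segMean 0 fun ζ => f ζ / (1 - ζ) := fun f =>
    funext (cesaro_eq f)
  refine isBoundedOperator_of_sqNorm_le (fun f hf => ?_) (fun f hf g hg c z hz => ?_) ?_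
  · rw [e]
    exact differentiableOn_segMean (by simp) (differentiableOn_div_one_sub hf.1)
      (segBound_cesaro hα₀ hf)
  · simp only [cesaro]
    split_ifs
    · rfl
    · rw [segmentIntegral_linear (c := c) (segmentIntegrable_cesaro hα₀ hf hz)
        (segmentIntegrable_cesaro hα₀ hg hz) fun ζ => by ring]
      ring
  · simpa only [e] using exists_sqNorm_segMean_cesaro_le hα₀ hα₂

lemma opA_isBoundedOperator {α : ℝ} (hα₀ : 0 < α) (hα₂ : α < 2) :
    IsBoundedOperator α opA := by
  -- Equality only in the disc: at `z = 1` the quotient takes the default value `0`, while the mean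
  -- is `f 1`.
  have e : ∀ f : ℂ → ℂ, Set.EqOn (opA f) (segMean 1 f) (ball 0 1) := fun f z hz =>
    one_div_sub_one_mul_segmentIntegral hz f
  refine isBoundedOperator_of_sqNorm_le (fun f hf => ?_) (fun f hf g hg c z hz => ?_) ?_
  · exact (differentiableOn_segMean (by simp) hf.1 (segBound_one hα₀ hα₂ hf)).congr (e f)
  · simp only [opA]
    rw [segmentIntegral_linear (c := c) (segmentIntegrable_opA hα₀ hα₂ hf hz)
      (segmentIntegrable_opA hα₀ hα₂ hg hz) fun ζ => rfl]
    ring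
  · simpa only [sqNorm_congr (e _)] using exists_sqNorm_segMean_one_le hα₀ hα₂

lemma opJ_isBoundedOperator {α : ℝ} (hα₀ : 0 < α) (hα₂ : α < 2) :
    IsBoundedOperator α opJ := by
  have e : ∀ f : ℂ → ℂ, Set.EqOn (opJ f) (segMean 1 fun ζ => f ζ / (-1 - ζ)) (ball 0 1) :=
    fun f z hz => one_div_sub_one_mul_segmentIntegral hz _
  refine isBoundedOperator_of_sqNorm_le (fun f hf => ?_) (fun f hf g hg c z hz => ?_) ?_
  · exact (differentiableOn_segMean (by simp) (differentiableOn_div_neg_one_sub hf.1)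
      (segBound_opJ hα₀ hα₂ hf)).congr (e f)
  · simp only [opJ]
    rw [segmentIntegral_linear (c := c) (segmentIntegrable_opJ hα₀ hα₂ hf hz)
      (segmentIntegrable_opJ hα₀ hα₂ hg hz) fun ζ => by ring]
    ring
  · simpa only [sqNorm_congr (e _)] using exists_sqNorm_segMean_opJ_le hα₀ hα₂

lemma hilbert_isBoundedOperator {α : ℝ} (hα₀ : 0 < α) (hα₂ : α < 2) :
    IsBoundedOperator α hilbert := by
  have e : ∀ f : ℂ → ℂ, hilbert f = hilbertMean f := fun f => funext (hilbert_eq f)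
  refine isBoundedOperator_of_sqNorm_le (fun f hf => ?_) (fun f hf g hg c z hz => ?_) ?_
  · rw [e]; exact differentiableOn_hilbertMean hα₀ hα₂ hf
  · exact segmentIntegral_linear (segmentIntegrable_hilbert hα₀ hα₂ hf hz)
      (segmentIntegrable_hilbert hα₀ hα₂ hg hz) fun ζ => by ring
  · simpa only [e] using exists_sqNorm_hilbertMean_le hα₀ hα₂

lemma reducedHilbert_isBoundedOperator {α : ℝ} (hα₀ : 0 < α) (hα₂ : α < 2) :
    IsBoundedOperator α reducedHilbert := by
  have e : ∀ f ∈ Space α, Set.EqOn (reducedHilbert f) (reducedHilbertMean f) (ball 0 1) :=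
    fun f hf z hz => reducedHilbert_eq hα₀ hα₂ hf hz
  refine isBoundedOperator_of_sqNorm_le (fun f hf => ?_) (fun f hf g hg c z hz => ?_) ?_
  · exact (differentiableOn_reducedHilbertMean hα₀ hα₂ hf).congr (e f hf)
  · simp only [reducedHilbert]
    rw [segmentIntegral_linear (c := c) (segmentIntegrable_reducedHilbert hα₀ hα₂ hf hz)
      (segmentIntegrable_reducedHilbert hα₀ hα₂ hg hz) fun ζ => by ring]
    ring
  · obtain ⟨C, hC, h⟩ := exists_sqNorm_reducedHilbertMean_le hα₀ hα₂
    exact ⟨C, hC, fun f hf => by rw [sqNorm_congr (e f hf)]; exact h f hf⟩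

end WeightedDirichlet

theorem mainTheorem3 (α : ℝ) (hα₀ : 0 < α) (hα₂ : α < 2) :
    -- the five integrals converge absolutely
    (∀ f ∈ WeightedDirichlet.Space α, ∀ z ∈ Metric.ball (0 : ℂ) 1,
      WeightedDirichlet.SegmentIntegrable 0 z (fun ζ => f ζ / (1 - ζ)) ∧
      WeightedDirichlet.SegmentIntegrable 1 z f ∧
      WeightedDirichlet.SegmentIntegrable 1 z (fun ζ => f ζ / (-1 - ζ)) ∧
      WeightedDirichlet.SegmentIntegrable 0 1 (fun ζ => f ζ / (1 - ζ * z)) ∧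
      WeightedDirichlet.SegmentIntegrable (-1) 1 (fun ζ => f ζ / (1 - ζ * z))) ∧
    -- the five operators are bounded
    WeightedDirichlet.IsBoundedOperator α WeightedDirichlet.cesaro ∧
    WeightedDirichlet.IsBoundedOperator α WeightedDirichlet.opA ∧
    WeightedDirichlet.IsBoundedOperator α WeightedDirichlet.opJ ∧
    WeightedDirichlet.IsBoundedOperator α WeightedDirichlet.hilbert ∧
    WeightedDirichlet.IsBoundedOperator α WeightedDirichlet.reducedHilbert := by
  refine ⟨fun f hf z hz => ⟨?_, ?_, ?_, ?_, ?_⟩, ?_, ?_, ?_, ?_, ?_⟩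
  · exact WeightedDirichlet.segmentIntegrable_cesaro hα₀ hf hz
  · exact WeightedDirichlet.segmentIntegrable_opA hα₀ hα₂ hf hz
  · exact WeightedDirichlet.segmentIntegrable_opJ hα₀ hα₂ hf hz
  · exact WeightedDirichlet.segmentIntegrable_hilbert hα₀ hα₂ hf hz
  · exact WeightedDirichlet.segmentIntegrable_reducedHilbert hα₀ hα₂ hf hz
  · exact WeightedDirichlet.cesaro_isBoundedOperator hα₀ hα₂
  · exact WeightedDirichlet.opA_isBoundedOperator hα₀ hα₂
  · exact WeightedDirichlet.opJ_isBoundedOperator hα₀ hα₂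
  · exact WeightedDirichlet.hilbert_isBoundedOperator hα₀ hα₂
  · exact WeightedDirichlet.reducedHilbert_isBoundedOperator hα₀ hα₂
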